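/- Let $(N^{2n+1},\varphi,\xi,\eta,g)$ be a Sasakian space form of constant $\varphi$-sectional curvature $c\neq 1$, that is, a contact metric manifold ($\varphi^2=-I+\eta\otimes\xi$, $\eta(\xi)=1$, $g(\varphi X,\varphi Y)=g(X,Y)-\eta(X)\eta(Y)$, $g(X,\varphi Y)=d\eta(X,Y)$ with $2\,d\eta(X,Y)=X\eta(Y)-Y\eta(X)-\eta([X,Y])$) such that $(\nabla_X\varphi)Y=g(X,Y)\xi-\eta(Y)X$, and such that every plane spanned by $X$ and $\varphi X$, with $X$ a unit vector orthogonal to $\xi$, has sectional curvature $c$. Let $I$ be an open interval and let $\gamma:I\to N$ be a smooth Frenet curve of osculating order $r$, $1\le r\le 2n+1$: there are orthonormal fields $E_1=\gamma'=T,E_2,\dots,E_r$ along $\gamma$ and positive functions $\kappa_1,\dots,\kappa_{r-1}$ on $I$ with $\nabla_TE_1=\kappa_1E_2$, $\nabla_TE_i=-\kappa_{i-1}E_{i-1}+\kappa_iE_{i+1}$ for $1<i<r$, and $\nabla_TE_r=-\kappa_{r-1}E_{r-1}$ (for $r=1$: $\nabla_TE_1=0$). A circle is a Frenet curve with $r=2$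 and $\kappa_1$ constant; a helix is one with $r=3$ and $\kappa_1,\kappa_2$ constant. The curve $\gamma$ is proper-biharmonic if $\nabla_T^3T-R(T,\nabla_TT)T=0$ on $I$ and $\nabla_TT$ does not vanish identically, where $R(X,Y)Z=\nabla_X\nabla_YZ-\nabla_Y\nabla_XZ-\nabla_{[X,Y]}Z$. Assume that $\eta(T)$ is not identically zero ($\gamma$ is not a Legendre curve) and that $\nabla_TT\parallel\varphi T$ along $\gamma$ (at every point one of the two vectors is a multiple of the other). Then $r\le 3$, and $\gamma$ is proper-biharmonic if and only if one of the following holds. (a) $\gamma$ is a circle with $$\eta(T)=\pm\sqrt{\frac{c+1-\sqrt{c^2-2c+5}}{2(c-1)}}\quad\text{and}\quad \kappa_1^2=\frac{c-1+\sqrt{c^2-2c+5}}{2}.$$ (b) $\gamma$ is a helix and there are a constant $\beta_0\in(0,2\pi)\setminus\{\frac{\pi}{2},\pi,\frac{3\pi}{2}\}$ and a sign $\varepsilon\in\{1,-1\}$ such that $\eta(T)=\cos\beta_0$ and $\varphi T=\varepsilon\sin\beta_0\,E_2$ along $\gamma$, $$\kappa_1^2+\varepsilon\sin(2\beta_0)\,\kappa_1+(1-c)\sin^4\beta_0=0,$$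 and, if $c<1$, moreover $|\cos\beta_0|\ge\sqrt{\frac{c-1}{c-2}}$. In case (b), $\kappa_2^2=(\kappa_1\cot\beta_0+\varepsilon)^2$ for every such $\beta_0$ and $\varepsilon$. -/

import Mathlib

open scoped Manifold ContDiff Bundle

noncomputable section

namespace SasakianCurves

/-! ### Local formulas in an open subset of a vector space -/

section Local

variable {E : Type*} [NormedAddCommGroup E] [NormedSpace ℝ E]

/-- The covector `w ↦ ½ (∂_u G(v, w) + ∂_v G(u, w) - ∂_w G(u, v))` at `y`, for a metric `G` given
in coordinates. -/
def koszulForm (G : E → E →L[ℝ] E →L[ℝ] ℝ) (y u v : E) : E →L[ℝ] ℝ :=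
  (1 / 2 : ℝ) • (fderiv ℝ G y u v + fderiv ℝ G y v u - ((fderiv ℝ G y).flip u).flip v)

/-- The Christoffel symbols `Γ_y(u, v) = u^i v^j Γ_ij^k ∂_k` of the Levi-Civita connection of the
metric `G`: the vector with `G_y(Γ_y(u, v), w) = koszulForm G y u v w` for all `w`. -/
def christoffel (G : E → E →L[ℝ] E →L[ℝ] ℝ) (y u v : E) : E :=
  (G y).inverse (koszulForm G y u v)

/-- The curvature `R(u, v) w = ∇_u ∇_v w - ∇_v ∇_u w` (constant fields `u`, `v`, `w`) at `y` of the
metric `G`. -/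
def localCurvature (G : E → E →L[ℝ] E →L[ℝ] ℝ) (y u v w : E) : E :=
  fderiv ℝ (fun z => christoffel G z v w) y u - fderiv ℝ (fun z => christoffel G z u w) y v
    + christoffel G y u (christoffel G y v w) - christoffel G y v (christoffel G y u w)

/-- The covariant derivative `(∇_u Φ)(w)` at `y` of a field of endomorphisms `Φ`, for the
Levi-Civita connection of `G`. -/
def localCovDerivEnd (G : E → E →L[ℝ] E →L[ℝ] ℝ) (Φ : E → E →L[ℝ] E) (y u w : E) : E :=
  fderiv ℝ Φ y u w + christoffel G y u (Φ y w) - Φ y (christoffel G y u w)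

/-- The exterior derivative of a 1-form, with the convention
`dη(X, Y) = ½ (X η(Y) - Y η(X) - η([X, Y]))` that is usual in contact metric geometry. -/
def localExtDeriv (η : E → E →L[ℝ] ℝ) (y u v : E) : ℝ :=
  (1 / 2 : ℝ) * (fderiv ℝ η y u v - fderiv ℝ η y v u)

end Local

/-! ### Riemannian manifolds and curves in them -/

section Riemannian

variable {m : ℕ} {M : Type*} [TopologicalSpace M] [ChartedSpace (EuclideanSpace ℝ (Fin m)) M]
  [IsManifold (𝓡 m) ∞ M]

/-- A smooth Riemannian metric on `M`. -/
abbrev Metric (m : ℕ) (M : Type*) [TopologicalSpace M] [ChartedSpace (EuclideanSpace ℝ (Fin m)) M]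
    [IsManifold (𝓡 m) ∞ M] : Type _ :=
  Bundle.ContMDiffRiemannianMetric (𝓡 m) ∞ (EuclideanSpace ℝ (Fin m))
    (fun x : M => TangentSpace (𝓡 m) x)

/-- The components of tangent vectors at `x` in the chart at `p` (that is, the differential at `x`
of the chart at `p`). -/
def toCoord (p x : M) : TangentSpace (𝓡 m) x →L[ℝ] EuclideanSpace ℝ (Fin m) :=
  (trivializationAt (EuclideanSpace ℝ (Fin m))
    (fun x : M => TangentSpace (𝓡 m) x) p).continuousLinearMapAt ℝ x

/-- The tangent vector at `x` with given components in the chart at `p`. -/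
def ofCoord (p x : M) : EuclideanSpace ℝ (Fin m) →L[ℝ] TangentSpace (𝓡 m) x :=
  (trivializationAt (EuclideanSpace ℝ (Fin m))
    (fun x : M => TangentSpace (𝓡 m) x) p).symmL ℝ x

/-- The metric in the chart at `p`. -/
def coordMetric (g : Metric m M) (p : M) (y : EuclideanSpace ℝ (Fin m)) :
    EuclideanSpace ℝ (Fin m) →L[ℝ] EuclideanSpace ℝ (Fin m) →L[ℝ] ℝ :=
  let x := (extChartAt (𝓡 m) p).symm y
  (ofCoord p x).precomp ℝ ∘L g.inner x ∘L ofCoord p x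

/-- A field of endomorphisms in the chart at `p`. -/
def coordEnd (φ : ∀ x : M, TangentSpace (𝓡 m) x →L[ℝ] TangentSpace (𝓡 m) x) (p : M)
    (y : EuclideanSpace ℝ (Fin m)) : EuclideanSpace ℝ (Fin m) →L[ℝ] EuclideanSpace ℝ (Fin m) :=
  let x := (extChartAt (𝓡 m) p).symm y
  toCoord p x ∘L φ x ∘L ofCoord p x

/-- A vector field in the chart at `p`. -/
def coordField (ξ : ∀ x : M, TangentSpace (𝓡 m) x) (p : M) (y : EuclideanSpace ℝ (Fin m)) :
    EuclideanSpace ℝ (Fin m) :=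
  let x := (extChartAt (𝓡 m) p).symm y
  toCoord p x (ξ x)

/-- A 1-form in the chart at `p`. -/
def coordForm (η : ∀ x : M, TangentSpace (𝓡 m) x →L[ℝ] ℝ) (p : M)
    (y : EuclideanSpace ℝ (Fin m)) : EuclideanSpace ℝ (Fin m) →L[ℝ] ℝ :=
  let x := (extChartAt (𝓡 m) p).symm y
  η x ∘L ofCoord p x

/-- The Riemann curvature tensor `R(u, v) w`, with
`R(X, Y) Z = ∇_X ∇_Y Z - ∇_Y ∇_X Z - ∇_[X, Y] Z`. -/
def curvature (g : Metric m M) (x : M) (u v w : TangentSpace (𝓡 m) x) : TangentSpace (𝓡 m) x :=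
  ofCoord x x (localCurvature (coordMetric g x) (extChartAt (𝓡 m) x x)
    (toCoord x x u) (toCoord x x v) (toCoord x x w))

/-- The velocity of a curve. -/
def velocity (γ : ℝ → M) (t : ℝ) : TangentSpace (𝓡 m) (γ t) :=
  mfderiv 𝓘(ℝ, ℝ) (𝓡 m) γ t (1 : ℝ)

/-- The field `V` along the curve `γ` is smooth on `J`. -/
def SmoothAlong (J : Set ℝ) (γ : ℝ → M) (V : ∀ t, TangentSpace (𝓡 m) (γ t)) : Prop :=
  ContMDiffOn 𝓘(ℝ, ℝ) (𝓡 m).tangent ∞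
    (fun t => (⟨γ t, V t⟩ : TangentBundle (𝓡 m) M)) J

/-- The covariant derivative `∇_T V` of a vector field `V` along the curve `γ` with velocity `T`,
for the Levi-Civita connection of `g`: at `t` its components in the chart at `γ t` are
`dV^k/dt + Γ_ij^k T^i V^j`. -/
def covDeriv (g : Metric m M) (γ : ℝ → M) (V : ∀ t, TangentSpace (𝓡 m) (γ t)) (t : ℝ) :
    TangentSpace (𝓡 m) (γ t) :=
  let p := γ t
  ofCoord p (γ t)
    (deriv (fun s => toCoord p (γ s) (V s)) t
      + christoffel (coordMetric g p) (extChartAt (𝓡 m) p (γ t))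
          (toCoord p (γ t) (velocity γ t)) (toCoord p (γ t) (V t)))

/-- `γ : J → M` is a Frenet curve of osculating order `r`, `1 ≤ r ≤ dim M`, with Frenet frame
`E 1, …, E r` (in particular `E 1 = γ'` is a unit vector) and curvatures `κ 1, …, κ (r - 1)`. -/
structure IsFrenetCurve (g : Metric m M) (J : Set ℝ) (γ : ℝ → M) (r : ℕ)
    (E : ℕ → ∀ t, TangentSpace (𝓡 m) (γ t)) (κ : ℕ → ℝ → ℝ) : Prop where
  one_le : 1 ≤ r
  le_dim : r ≤ m
  smooth_curve : ContMDiffOn 𝓘(ℝ, ℝ) (𝓡 m) ∞ γ J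
  smooth_frame : ∀ i, 1 ≤ i → i ≤ r → SmoothAlong J γ (E i)
  smooth_curvature : ∀ i, 1 ≤ i → i < r → ContDiffOn ℝ ∞ (κ i) J
  frame_one : ∀ t ∈ J, E 1 t = velocity γ t
  orthonormal : ∀ t ∈ J, ∀ i j, 1 ≤ i → i ≤ r → 1 ≤ j → j ≤ r →
    g.inner (γ t) (E i t) (E j t) = if i = j then 1 else 0
  curvature_pos : ∀ t ∈ J, ∀ i, 1 ≤ i → i < r → 0 < κ i t
  frenet : ∀ t ∈ J, ∀ i, 1 ≤ i → i ≤ r →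
    covDeriv g γ (E i) t =
      (if 1 < i then -κ (i - 1) t • E (i - 1) t else 0)
        + (if i < r then κ i t • E (i + 1) t else 0)

/-- The tension field `τ(γ) = ∇_T T`. -/
def tension (g : Metric m M) (γ : ℝ → M) (t : ℝ) : TangentSpace (𝓡 m) (γ t) :=
  covDeriv g γ (velocity γ) t

/-- The bitension field `τ₂(γ) = -Δ τ(γ) - trace R(dγ, τ(γ)) dγ = ∇_T ∇_T τ(γ) - R(T, τ(γ)) T`. -/
def bitension (g : Metric m M) (γ : ℝ → M) (t : ℝ) : TangentSpace (𝓡 m) (γ t) :=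
  covDeriv g γ (covDeriv g γ (tension g γ)) t
    - curvature g (γ t) (velocity γ t) (tension g γ t) (velocity γ t)

/-- `γ` is harmonic on `J`. -/
def IsHarmonic (g : Metric m M) (J : Set ℝ) (γ : ℝ → M) : Prop :=
  ∀ t ∈ J, tension g γ t = 0

/-- `γ` is biharmonic on `J`. -/
def IsBiharmonic (g : Metric m M) (J : Set ℝ) (γ : ℝ → M) : Prop :=
  ∀ t ∈ J, bitension g γ t = 0

/-- `γ` is biharmonic and not harmonic on `J`. -/
def IsProperBiharmonic (g : Metric m M) (J : Set ℝ) (γ : ℝ → M) : Prop :=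
  IsBiharmonic g J γ ∧ ¬ IsHarmonic g J γ

/-- `k` is constant on `J`. -/
def IsConstOn (J : Set ℝ) (k : ℝ → ℝ) : Prop :=
  ∃ a : ℝ, ∀ t ∈ J, k t = a

/-- A Frenet curve of osculating order `r` with curvatures `κ` is a circle. -/
def IsCircle (J : Set ℝ) (r : ℕ) (κ : ℕ → ℝ → ℝ) : Prop :=
  r = 2 ∧ IsConstOn J (κ 1)

/-- A Frenet curve of osculating order `r` with curvatures `κ` is a helix (of order 3). -/
def IsHelix (J : Set ℝ) (r : ℕ) (κ : ℕ → ℝ → ℝ) : Prop :=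
  r = 3 ∧ IsConstOn J (κ 1) ∧ IsConstOn J (κ 2)

/-- Two vectors are parallel: one of them is a multiple of the other. -/
def Parallel {V : Type*} [AddCommGroup V] [Module ℝ V] (u v : V) : Prop :=
  (∃ a : ℝ, u = a • v) ∨ ∃ a : ℝ, v = a • u

end Riemannian

/-! ### Sasakian space forms -/

section Sasakian

/-- A contact metric structure `(φ, ξ, η, g)` on a manifold of dimension `2n + 1`.
The equation `g(X, φY) = dη(X, Y)` is required in the chart at every point. -/
structure ContactMetricStructure (n : ℕ) (M : Type*) [TopologicalSpace M]
    [ChartedSpace (EuclideanSpace ℝ (Fin (2 * n + 1))) M] [IsManifold (𝓡 (2 * n + 1)) ∞ M] where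
  g : Metric (2 * n + 1) M
  φ : ∀ x : M, TangentSpace (𝓡 (2 * n + 1)) x →L[ℝ] TangentSpace (𝓡 (2 * n + 1)) x
  ξ : ∀ x : M, TangentSpace (𝓡 (2 * n + 1)) x
  η : ∀ x : M, TangentSpace (𝓡 (2 * n + 1)) x →L[ℝ] ℝ
  smooth_φ : ∀ p : M, ContDiffOn ℝ ∞ (coordEnd φ p) (extChartAt (𝓡 (2 * n + 1)) p).target
  smooth_ξ : ∀ p : M, ContDiffOn ℝ ∞ (coordField ξ p) (extChartAt (𝓡 (2 * n + 1)) p).target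
  smooth_η : ∀ p : M, ContDiffOn ℝ ∞ (coordForm η p) (extChartAt (𝓡 (2 * n + 1)) p).target
  φ_sq : ∀ x v, φ x (φ x v) = -v + η x v • ξ x
  η_ξ : ∀ x, η x (ξ x) = 1
  g_φ : ∀ x u v, g.inner x (φ x u) (φ x v) = g.inner x u v - η x u * η x v
  g_φ_eq_dη : ∀ p : M, ∀ y ∈ (extChartAt (𝓡 (2 * n + 1)) p).target, ∀ u v,
    coordMetric g p y u (coordEnd φ p y v) = localExtDeriv (coordForm η p) y u v

variable {n : ℕ} {M : Type*} [TopologicalSpace M]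
  [ChartedSpace (EuclideanSpace ℝ (Fin (2 * n + 1))) M] [IsManifold (𝓡 (2 * n + 1)) ∞ M]

/-- A contact metric structure is Sasakian if `(∇_X φ)(Y) = g(X, Y) ξ - η(Y) X`. -/
def ContactMetricStructure.IsSasakian (S : ContactMetricStructure n M) : Prop :=
  ∀ p : M, ∀ y ∈ (extChartAt (𝓡 (2 * n + 1)) p).target, ∀ u w,
    localCovDerivEnd (coordMetric S.g p) (coordEnd S.φ p) y u w =
      coordMetric S.g p y u w • coordField S.ξ p y - coordForm S.η p y w • u

/-- Every `φ`-sectional curvature, that is the sectional curvature of the plane spanned by `u` and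
`φ u` for a unit vector `u` orthogonal to `ξ`, equals `c`. -/
def ContactMetricStructure.HasConstantPhiSectionalCurvature (S : ContactMetricStructure n M)
    (c : ℝ) : Prop :=
  ∀ x : M, ∀ u : TangentSpace (𝓡 (2 * n + 1)) x,
    S.g.inner x u u = 1 → S.g.inner x u (S.ξ x) = 0 →
      S.g.inner x (curvature S.g x u (S.φ x u) (S.φ x u)) u = c

/-- A Sasakian space form `M(c)`. -/
def ContactMetricStructure.IsSasakianSpaceForm (S : ContactMetricStructure n M) (c : ℝ) : Prop :=
  S.IsSasakian ∧ S.HasConstantPhiSectionalCurvature c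

/-- Condition (a): `γ` is a circle with `η(T) = ±√((c+1-√(c²-2c+5)) / (2(c-1)))` and
`κ₁² = (c-1+√(c²-2c+5)) / 2`. -/
def CircleCondition (S : ContactMetricStructure n M) (c : ℝ) (J : Set ℝ) (γ : ℝ → M) (r : ℕ)
    (κ : ℕ → ℝ → ℝ) : Prop :=
  IsCircle J r κ ∧
  (∃ ε : ℝ, (ε = 1 ∨ ε = -1) ∧ ∀ t ∈ J, S.η (γ t) (velocity γ t) =
    ε * √((c + 1 - √(c ^ 2 - 2 * c + 5)) / (2 * (c - 1)))) ∧
  ∀ t ∈ J, κ 1 t ^ 2 = (c - 1 + √(c ^ 2 - 2 * c + 5)) / 2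

/-- Condition (b) for the angle `β₀` and the sign `ε`, which is the sign in `φT = ε sin β₀ E₂`:
`γ` is a helix with `η(T) = cos β₀` and `κ₁² + ε sin(2β₀) κ₁ + (1 - c) sin⁴ β₀ = 0`, where
`β₀ ∈ (0, 2π) ∖ {π/2, π, 3π/2}` and, if `c < 1`, `|cos β₀| ≥ √((c - 1)/(c - 2))`. -/
def HelixCondition (S : ContactMetricStructure n M) (c : ℝ) (J : Set ℝ) (γ : ℝ → M) (r : ℕ)
    (E : ℕ → ∀ t, TangentSpace (𝓡 (2 * n + 1)) (γ t)) (κ : ℕ → ℝ → ℝ) (β₀ ε : ℝ) : Prop :=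
  IsHelix J r κ ∧
  (β₀ ∈ Set.Ioo 0 (2 * Real.pi) \ {Real.pi / 2, Real.pi, 3 * Real.pi / 2}) ∧
  (c < 1 → √((c - 1) / (c - 2)) ≤ |Real.cos β₀|) ∧
  (ε = 1 ∨ ε = -1) ∧
  (∀ t ∈ J, S.η (γ t) (velocity γ t) = Real.cos β₀) ∧
  (∀ t ∈ J, S.φ (γ t) (velocity γ t) = (ε * Real.sin β₀) • E 2 t) ∧
  ∀ t ∈ J, κ 1 t ^ 2 + ε * Real.sin (2 * β₀) * κ 1 t + (1 - c) * Real.sin β₀ ^ 4 = 0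

end Sasakian

end SasakianCurves

end

/-! Let T be the velocity. In a Sasakian manifold ∇_T ξ = -φT, so η(T)' = η(∇_T T), which vanishes
because ∇_T T ∥ φT; hence η(T) = f is constant (`exists_η_velocity_eq`). If r ≥ 2, then φT = σE₂
with σ constant, σ ≠ 0 and σ² = 1 - f² (`exists_isSlantCurve`).

Put N = ξ - fT. Differentiating E₂ = σ⁻¹φT and N with the Sasakian identity for ∇φ shows that ∇_T
preserves the span of T, E₂, N. This gives r ≤ 3 (`order_le_three`), and the length of the
N-component of ∇_T E₂ gives κ₂² = (1 + κ₁f/σ)², with 0 in place of κ₂ when r = 2.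

The only curvature needed is R(T, φT)T = -(1 + (c-1)(1-η(T)²))φT (`curvature_tangent`). It follows
from the Ricci identity for φ, which gives R(·,·)ξ, and from polarising the condition on φ-sectional
curvature. The T-component of the bitension field is then -3κ₁κ₁', so biharmonicity forces κ₁ to be
constant, and what remains is the single equation κ₁² + (1 + κ₁f/σ)² = 1 + (c-1)σ²
(`isBiharmonic_iff`). For r = 2 the second square vanishes, and a quadratic equation for f² yields
(a). For r = 3, writing f = cos β₀ and σ = ε sin β₀ and multiplying by σ² yields (b); the bound on
|cos β₀| says that the discriminant is nonnegative.

The tensor identities are proved in coordinates and then transported to M through the chart centred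
at the point in question. -/

namespace SasakianCurves

/-! ### Levi-Civita connection and curvature in coordinates -/

section LocalMetric

open scoped Topology

variable {E : Type*} [NormedAddCommGroup E] [NormedSpace ℝ E]

/-- A Riemannian metric on an open subset of a vector space. -/
structure IsLocalMetric (U : Set E) (G : E → E →L[ℝ] E →L[ℝ] ℝ) : Prop where
  isOpen : IsOpen U
  smooth : ContDiffOn ℝ ∞ G U
  symm : ∀ y ∈ U, ∀ u v, G y u v = G y v u
  pos : ∀ y ∈ U, ∀ v, v ≠ 0 → 0 < G y v v

/-- The covariant derivative at `y` in the direction `u` of a vector field in coordinates. -/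
noncomputable def localCovDeriv (G : E → E →L[ℝ] E →L[ℝ] ℝ) (A : E → E) (y u : E) : E :=
  fderiv ℝ A y u + christoffel G y u (A y)

theorem differentiableAt_fderiv_apply {F : Type*} [NormedAddCommGroup F] [NormedSpace ℝ F]
    {f : E → F} {y : E} (hf : ContDiffAt ℝ ∞ f y) (u : E) :
    DifferentiableAt ℝ (fun z => fderiv ℝ f z u) y :=
  ((hf.fderiv_right (m := 1) (by norm_cast)).differentiableAt (by simp)).clm_apply
    (differentiableAt_const u)

theorem contDiffOn_fderiv_apply {F : Type*} [NormedAddCommGroup F] [NormedSpace ℝ F]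
    {f : E → F} {U : Set E} (hU : IsOpen U) (hf : ContDiffOn ℝ ∞ f U) (u : E) :
    ContDiffOn ℝ ∞ (fun z => fderiv ℝ f z u) U :=
  (hf.fderiv_of_isOpen hU (m := ∞) (by norm_cast)).clm_apply contDiffOn_const

/-- Schwarz's theorem for iterated directional derivatives. It removes the second derivatives of the
field, or of the metric, from commutators of covariant derivatives. -/
theorem fderiv_fderiv_apply_symm {F : Type*} [NormedAddCommGroup F] [NormedSpace ℝ F]
    {f : E → F} {y : E} (hf : ContDiffAt ℝ ∞ f y) (u v : E) :
    fderiv ℝ (fun z => fderiv ℝ f z v) y u = fderiv ℝ (fun z => fderiv ℝ f z u) y v := by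
  have hd : DifferentiableAt ℝ (fderiv ℝ f) y :=
    (hf.fderiv_right (m := 1) (by norm_cast)).differentiableAt (by simp)
  have key : ∀ v, fderiv ℝ (fun z => fderiv ℝ f z v) y = (fderiv ℝ (fderiv ℝ f) y).flip v := by
    intro v
    rw [(hd.hasFDerivAt.clm_apply (hasFDerivAt_const v y)).fderiv]
    ext; simp
  rw [key, key]
  exact (hf.isSymmSndFDerivAt (by simp; norm_cast)) u v

-- Bilinearity of the Christoffel symbols needs nothing of `G`: the Koszul form is bilinear in its
-- two arguments, and `ContinuousLinearMap.inverse` is a linear map even at a non-invertible `G y`,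
-- where it is 0.
set_option synthInstance.maxHeartbeats 100000 in
theorem christoffel_add_left (G : E → E →L[ℝ] E →L[ℝ] ℝ) (y u u' v : E) :
    christoffel G y (u + u') v = christoffel G y u v + christoffel G y u' v := by
  simp only [christoffel, ← map_add]
  congr 1
  ext w
  simp [koszulForm]; ring

set_option synthInstance.maxHeartbeats 100000 in
theorem christoffel_smul_left (G : E → E →L[ℝ] E →L[ℝ] ℝ) (y : E) (a : ℝ) (u v : E) :
    christoffel G y (a • u) v = a • christoffel G y u v := by
  simp only [christoffel, ← map_smul]
  congr 1
  ext w
  simp [koszulForm]; ring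

set_option synthInstance.maxHeartbeats 100000 in
theorem christoffel_add_right (G : E → E →L[ℝ] E →L[ℝ] ℝ) (y u v v' : E) :
    christoffel G y u (v + v') = christoffel G y u v + christoffel G y u v' := by
  simp only [christoffel, ← map_add]
  congr 1
  ext w
  simp [koszulForm]; ring

set_option synthInstance.maxHeartbeats 100000 in
theorem christoffel_smul_right (G : E → E →L[ℝ] E →L[ℝ] ℝ) (y u : E) (a : ℝ) (v : E) :
    christoffel G y u (a • v) = a • christoffel G y u v := by
  simp only [christoffel, ← map_smul]
  congr 1
  ext w
  simp [koszulForm]; ring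

theorem localCurvature_antisymm (G : E → E →L[ℝ] E →L[ℝ] ℝ) (y u v w : E) :
    localCurvature G y u v w = -localCurvature G y v u w := by
  simp only [localCurvature]; abel

theorem localCurvature_eq_localCovDeriv (G : E → E →L[ℝ] E →L[ℝ] ℝ) (y u v w : E) :
    localCurvature G y u v w = localCovDeriv G (fun z => christoffel G z v w) y u
      - localCovDeriv G (fun z => christoffel G z u w) y v := by
  simp only [localCurvature, localCovDeriv]; abel

/-- The Christoffel symbols as linear maps in the second argument. -/
noncomputable def christoffelL [FiniteDimensional ℝ E] (G : E → E →L[ℝ] E →L[ℝ] ℝ) (v y : E) :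
    E →L[ℝ] E :=
  LinearMap.toContinuousLinearMap
    { toFun := christoffel G y v
      map_add' := christoffel_add_right G y v
      map_smul' := fun a w => christoffel_smul_right G y v a w }

theorem christoffelL_apply [FiniteDimensional ℝ E] (G : E → E →L[ℝ] E →L[ℝ] ℝ) (v y w : E) :
    christoffelL G v y w = christoffel G y v w := rfl

namespace IsLocalMetric

variable {U : Set E} {G : E → E →L[ℝ] E →L[ℝ] ℝ} (hG : IsLocalMetric U G) {y : E} (hy : y ∈ U)

include hG hy

theorem mem_nhds : U ∈ 𝓝 y := hG.isOpen.mem_nhds hy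

theorem contDiffAt : ContDiffAt ℝ ∞ G y := hG.smooth.contDiffAt (hG.mem_nhds hy)

theorem differentiableAt : DifferentiableAt ℝ G y :=
  (hG.contDiffAt hy).differentiableAt (by simp)

theorem ext_inner {v w : E} (h : ∀ z, G y v z = G y w z) : v = w := by
  by_contra hne
  have := hG.pos y hy (v - w) (sub_ne_zero.2 hne)
  simp [h] at this

theorem fderiv_apply_apply (u v w : E) :
    fderiv ℝ (fun z => G z v w) y u = fderiv ℝ G y u v w := by
  have := (((hG.differentiableAt hy).hasFDerivAt.clm_apply (hasFDerivAt_const v y)).clm_apply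
    (hasFDerivAt_const w y))
  rw [this.fderiv]; simp

theorem fderiv_symm (u v w : E) : fderiv ℝ G y u v w = fderiv ℝ G y u w v := by
  have h : (fun z => G z v w) =ᶠ[𝓝 y] fun z => G z w v := by
    filter_upwards [hG.mem_nhds hy] with z hz using hG.symm z hz v w
  rw [← hG.fderiv_apply_apply hy, ← hG.fderiv_apply_apply hy, h.fderiv_eq]

variable [FiniteDimensional ℝ E]

/-- Positivity makes `G y` injective, and a finite-dimensional space has the dimension of its dual.
Thus `inverse` in the definition of `christoffel` is a genuine inverse on U. -/
theorem isInvertible : (G y).IsInvertible := by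
  have hinj : Function.Injective (G y : E →ₗ[ℝ] E →L[ℝ] ℝ) := by
    intro v w h
    refine hG.ext_inner hy fun z => ?_
    simp only [ContinuousLinearMap.coe_coe] at h
    rw [h]
  have hdim : Module.finrank ℝ E = Module.finrank ℝ (E →L[ℝ] ℝ) := by
    rw [← (LinearMap.toContinuousLinearMap : (E →ₗ[ℝ] ℝ) ≃ₗ[ℝ] E →L[ℝ] ℝ).finrank_eq]
    exact (Subspace.dual_finrank_eq (K := ℝ) (V := E)).symm
  exact ⟨(LinearEquiv.ofInjectiveOfFinrankEq _ hinj hdim).toContinuousLinearEquiv, by ext; rfl⟩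

theorem inner_christoffel (u v w : E) :
    G y (christoffel G y u v) w
      = (1 / 2 : ℝ) * (fderiv ℝ G y u v w + fderiv ℝ G y v u w - fderiv ℝ G y w u v) := by
  rw [christoffel, (hG.isInvertible hy).self_apply_inverse, koszulForm]
  simp

/-- The Levi-Civita connection is torsion-free. -/
theorem christoffel_symm (u v : E) : christoffel G y u v = christoffel G y v u := by
  refine hG.ext_inner hy fun w => ?_
  rw [hG.inner_christoffel hy, hG.inner_christoffel hy, hG.fderiv_symm hy w u v]
  ring

/-- The Levi-Civita connection is metric. -/
theorem fderiv_eq (u v w : E) :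
    fderiv ℝ G y u v w = G y (christoffel G y u v) w + G y v (christoffel G y u w) := by
  rw [hG.symm y hy v, hG.inner_christoffel hy, hG.inner_christoffel hy, hG.fderiv_symm hy u w v,
    hG.fderiv_symm hy w u v, hG.fderiv_symm hy v u w]
  ring

omit hy in
theorem contDiffOn_christoffel (u v : E) : ContDiffOn ℝ ∞ (fun z => christoffel G z u v) U := by
  have h1 : ContDiffOn ℝ ∞ (fun z => (G z).inverse) U := fun z hz =>
    (((hG.isInvertible hz).contDiffAt_map_inverse (n := ∞)).comp z
      (hG.contDiffAt hz)).contDiffWithinAt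
  have h2 : ∀ a b : E, ContDiffOn ℝ ∞ (fun z => fderiv ℝ G z a b) U := fun a b =>
    (contDiffOn_fderiv_apply hG.isOpen hG.smooth a).clm_apply contDiffOn_const
  have h3 : ContDiffOn ℝ ∞ (fun z => ((fderiv ℝ G z).flip u).flip v) U := by
    refine contDiffOn_clm_apply.2 fun w => ?_
    simpa using (h2 w u).clm_apply (contDiffOn_const (c := v))
  exact h1.clm_apply ((((h2 u v).add (h2 v u)).sub h3).const_smul (1 / 2 : ℝ))

theorem differentiableAt_christoffel (u v : E) :
    DifferentiableAt ℝ (fun z => christoffel G z u v) y :=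
  ((hG.contDiffOn_christoffel u v).contDiffAt (hG.mem_nhds hy)).differentiableAt (by simp)

omit hy in
theorem contDiffOn_christoffelL (v : E) : ContDiffOn ℝ ∞ (christoffelL G v) U :=
  contDiffOn_clm_apply.2 fun w => hG.contDiffOn_christoffel v w

theorem differentiableAt_christoffelL (v : E) : DifferentiableAt ℝ (christoffelL G v) y :=
  ((hG.contDiffOn_christoffelL v).contDiffAt (hG.mem_nhds hy)).differentiableAt (by simp)

theorem fderiv_inner {A B : E → E} (hA : DifferentiableAt ℝ A y) (hB : DifferentiableAt ℝ B y)
    (u : E) : fderiv ℝ (fun z => G z (A z) (B z)) y u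
      = G y (localCovDeriv G A y u) (B y) + G y (A y) (localCovDeriv G B y u) := by
  have := (((hG.differentiableAt hy).hasFDerivAt.clm_apply hA.hasFDerivAt).clm_apply
    hB.hasFDerivAt)
  rw [this.fderiv]
  simp [localCovDeriv, hG.fderiv_eq hy]
  ring

omit hy in
set_option synthInstance.maxHeartbeats 100000 in
/-- The Levi-Civita connection is metric along curves. -/
theorem hasDerivAt_inner {x A B : ℝ → E} {t : ℝ} {x' A' B' : E} (hx : HasDerivAt x x' t)
    (hA : HasDerivAt A A' t) (hB : HasDerivAt B B' t) (ht : x t ∈ U) :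
    HasDerivAt (fun s => G (x s) (A s) (B s))
      (G (x t) (A' + christoffel G (x t) x' (A t)) (B t)
        + G (x t) (A t) (B' + christoffel G (x t) x' (B t))) t := by
  have h1 : HasDerivAt (fun s => G (x s)) (fderiv ℝ G (x t) x') t :=
    HasFDerivAt.comp_hasDerivAt (E := E →L[ℝ] E →L[ℝ] ℝ) (l := G) (f := x) t
      (hG.differentiableAt ht).hasFDerivAt hx
  have h2 := HasDerivAt.clm_apply (F := E) (G := E →L[ℝ] ℝ) (c := fun s => G (x s)) (u := A) h1 hA
  have h := HasDerivAt.clm_apply (F := E) (G := ℝ) (u := B) h2 hB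
  refine h.congr_deriv ?_
  simp only [add_apply, map_add, hG.fderiv_eq ht]
  ring

omit hy in
theorem localCurvature_add_mid (hy : y ∈ U) (u v v' w : E) :
    localCurvature G y u (v + v') w = localCurvature G y u v w + localCurvature G y u v' w := by
  simp only [localCurvature, christoffel_add_left]
  rw [fderiv_fun_add (hG.differentiableAt_christoffel hy _ _)
    (hG.differentiableAt_christoffel hy _ _)]
  simp only [christoffel_add_right, map_add, add_apply]
  abel

theorem localCurvature_smul_mid (u : E) (a : ℝ) (v w : E) :
    localCurvature G y u (a • v) w = a • localCurvature G y u v w := by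
  simp only [localCurvature, christoffel_smul_left]
  rw [fderiv_fun_const_smul (hG.differentiableAt_christoffel hy _ _)]
  simp only [christoffel_smul_right, map_smul, smul_apply]
  module

theorem localCurvature_add_right (u v w w' : E) :
    localCurvature G y u v (w + w') = localCurvature G y u v w + localCurvature G y u v w' := by
  simp only [localCurvature, christoffel_add_right]
  rw [fderiv_fun_add (hG.differentiableAt_christoffel hy _ _)
    (hG.differentiableAt_christoffel hy _ _),
    fderiv_fun_add (hG.differentiableAt_christoffel hy _ _)
    (hG.differentiableAt_christoffel hy _ _)]
  simp only [add_apply]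
  abel

theorem localCurvature_smul_right (u v : E) (a : ℝ) (w : E) :
    localCurvature G y u v (a • w) = a • localCurvature G y u v w := by
  simp only [localCurvature, christoffel_smul_right]
  rw [fderiv_fun_const_smul (hG.differentiableAt_christoffel hy _ _),
    fderiv_fun_const_smul (hG.differentiableAt_christoffel hy _ _)]
  simp only [smul_apply]
  module

/-- The first Bianchi identity. -/
theorem localCurvature_bianchi (u v w : E) :
    localCurvature G y u v w + localCurvature G y v w u + localCurvature G y w u v = 0 := by
  have key : ∀ a b c, fderiv ℝ (fun z => christoffel G z a b) y c
      = fderiv ℝ (fun z => christoffel G z b a) y c := by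
    intro a b c
    have h : (fun z => christoffel G z a b) =ᶠ[𝓝 y] fun z => christoffel G z b a := by
      filter_upwards [hG.mem_nhds hy] with z hz using hG.christoffel_symm hz a b
    rw [h.fderiv_eq]
  simp only [localCurvature]
  rw [key v w u, key w u v, key u v w, hG.christoffel_symm hy v w, hG.christoffel_symm hy w u,
    hG.christoffel_symm hy u v]
  abel

/-- The curvature is skew-adjoint. -/
theorem localCurvature_skew (u v w z : E) :
    G y (localCurvature G y u v w) z = -G y w (localCurvature G y u v z) := by
  have hS : ContDiffAt ℝ ∞ (fun x => G x w z) y :=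
    ((hG.contDiffAt hy).clm_apply contDiffAt_const).clm_apply contDiffAt_const
  -- Metric compatibility is used twice on the function x ↦ `G x w z`. The mixed terms are symmetric
  -- in u and v, so equality of the second derivatives leaves only the curvature terms.
  have key : ∀ u v, fderiv ℝ (fun x => fderiv ℝ (fun x => G x w z) x v) y u
      = G y (localCovDeriv G (fun x => christoffel G x v w) y u) z
        + G y (christoffel G y v w) (christoffel G y u z)
        + (G y (christoffel G y u w) (christoffel G y v z)
          + G y w (localCovDeriv G (fun x => christoffel G x v z) y u)) := by
    intro u v
    have h : (fun x => fderiv ℝ (fun x => G x w z) x v) =ᶠ[𝓝 y]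
        fun x => G x (christoffel G x v w) z + G x w (christoffel G x v z) := by
      filter_upwards [hG.mem_nhds hy] with x hx
      rw [hG.fderiv_apply_apply hx, hG.fderiv_eq hx]
    have hd1 := hG.differentiableAt_christoffel hy v w
    have hd2 := hG.differentiableAt_christoffel hy v z
    have hc : ∀ a : E, DifferentiableAt ℝ (fun _ : E => a) y := fun a => differentiableAt_const a
    have hGd := hG.differentiableAt hy
    rw [h.fderiv_eq, fderiv_fun_add ((hGd.clm_apply hd1).clm_apply (hc z))
      ((hGd.clm_apply (hc w)).clm_apply hd2), add_apply,
      hG.fderiv_inner hy hd1 (hc z), hG.fderiv_inner hy (hc w) hd2]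
    simp [localCovDeriv]
  have h := fderiv_fderiv_apply_symm hS u v
  rw [key, key] at h
  simp only [localCurvature_eq_localCovDeriv, map_sub, sub_apply]
  linarith

/-- The curvature is the commutator of covariant derivatives. -/
theorem localCurvature_eq_commutator {X : E → E} (hX : ContDiffAt ℝ ∞ X y) (u v : E) :
    localCurvature G y u v (X y) = localCovDeriv G (fun z => localCovDeriv G X z v) y u
      - localCovDeriv G (fun z => localCovDeriv G X z u) y v := by
  -- In the product rule the derivative falls either on the Christoffel symbols, with X frozen at
  -- its value at y, or on X. Only the frozen term is not symmetric in u and v, and its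
  -- antisymmetrisation is the curvature.
  have hXd : DifferentiableAt ℝ X y := hX.differentiableAt (by simp)
  have key : ∀ u v, localCovDeriv G (fun z => localCovDeriv G X z v) y u
      = fderiv ℝ (fun z => fderiv ℝ X z v) y u
        + localCovDeriv G (fun z => christoffel G z v (X y)) y u
        + christoffel G y v (fderiv ℝ X y u) + christoffel G y u (fderiv ℝ X y v) := by
    intro u v
    have h1 : fderiv ℝ (fun z => christoffelL G v z (X z)) y u
        = fderiv ℝ (fun z => christoffelL G v z (X y)) y u
          + christoffelL G v y (fderiv ℝ X y u) := by
      rw [((hG.differentiableAt_christoffelL hy v).hasFDerivAt.clm_apply hXd.hasFDerivAt).fderiv,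
        ((hG.differentiableAt_christoffelL hy v).hasFDerivAt.clm_apply
          (hasFDerivAt_const (X y) y)).fderiv]
      simp [add_comm]
    have h2 := (hG.differentiableAt_christoffelL hy v).clm_apply hXd
    simp only [christoffelL_apply] at h1 h2
    simp only [localCovDeriv]
    rw [fderiv_fun_add (differentiableAt_fderiv_apply hX v) h2, add_apply, h1,
      christoffel_add_right]
    abel
  rw [key, key, localCurvature_eq_localCovDeriv, fderiv_fderiv_apply_symm hX u v]
  abel

end IsLocalMetric

end LocalMetric

/-! ### Pointwise algebra of almost contact structures and Sasakian curvature -/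

section Algebra

set_option linter.unusedSectionVars false

variable {V : Type*} [AddCommGroup V] [TopologicalSpace V] [IsTopologicalAddGroup V] [Module ℝ V]
  [ContinuousSMul ℝ V]

/-- An almost contact metric structure on a vector space. -/
structure IsAlmostContact (B : V →L[ℝ] V →L[ℝ] ℝ) (φ : V →L[ℝ] V) (ξ : V) (η : V →L[ℝ] ℝ) :
    Prop where
  symm : ∀ u v, B u v = B v u
  pos : ∀ v, v ≠ 0 → 0 < B v v
  φ_sq : ∀ v, φ (φ v) = -v + η v • ξ
  η_ξ : η ξ = 1
  inner_φ : ∀ u v, B (φ u) (φ v) = B u v - η u * η v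

namespace IsAlmostContact

variable {B : V →L[ℝ] V →L[ℝ] ℝ} {φ : V →L[ℝ] V} {ξ : V} {η : V →L[ℝ] ℝ}
  (h : IsAlmostContact B φ ξ η)

include h

theorem ext_inner {v w : V} (H : ∀ z, B v z = B w z) : v = w := by
  by_contra hne
  have := h.pos (v - w) (sub_ne_zero.2 hne)
  simp [H] at this

/-- Since φ²ξ = 0, applying `φ_sq` to φξ gives φξ = aξ with a = η(φξ). Then 0 = φ²ξ = a²ξ. -/
theorem φ_ξ : φ ξ = 0 := by
  have h1 : φ (φ ξ) = 0 := by rw [h.φ_sq, h.η_ξ]; simp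
  have h2 := h.φ_sq (φ ξ)
  rw [h1, map_zero] at h2
  have h3 : φ ξ = η (φ ξ) • ξ := by
    rw [eq_comm, neg_add_eq_zero] at h2; exact h2
  have h4 : η (φ ξ) * η (φ ξ) = 0 := by
    have := congrArg η h1
    rw [h3, map_smul, h3] at this
    simpa [h.η_ξ] using this
  rw [h3, mul_self_eq_zero.1 h4, zero_smul]

theorem η_eq (u : V) : η u = B u ξ := by
  have := h.inner_φ u ξ
  rw [h.φ_ξ, map_zero, h.η_ξ] at this
  linarith

theorem inner_ξ_ξ : B ξ ξ = 1 := by rw [← h.η_eq, h.η_ξ]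

/-- The vector φ³u is computed in two ways, as φ²(φu) and as φ(φ²u). -/
theorem η_φ (u : V) : η (φ u) = 0 := by
  have h1 := h.φ_sq (φ u)
  rw [h.φ_sq u] at h1
  simp only [map_add, map_neg, map_smul, h.φ_ξ, smul_zero, add_zero] at h1
  have := congrArg η h1
  simpa [h.η_ξ] using this

theorem φ_skew (u v : V) : B (φ u) v = -B u (φ v) := by
  have h1 := h.inner_φ (φ u) v
  rw [h.φ_sq, h.η_φ] at h1
  simp only [map_add, map_neg, map_smul, add_apply, neg_apply, smul_apply, smul_eq_mul,
    h.symm ξ, ← h.η_eq, h.η_φ] at h1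
  linarith

theorem inner_φ_self (u : V) : B u (φ u) = 0 := by
  have := h.φ_skew u u
  rw [h.symm] at this
  linarith

theorem eq_zero_of_φ_eq_zero {u : V} (h1 : φ u = 0) (h2 : η u = 0) : u = 0 := by
  have := h.φ_sq u
  rw [h1, h2] at this
  simpa using this.symm

end IsAlmostContact

/-- The algebraic properties of the curvature of a Sasakian space form at a point. -/
structure IsSasakianCurvature (B : V →L[ℝ] V →L[ℝ] ℝ) (φ : V →L[ℝ] V) (ξ : V) (η : V →L[ℝ] ℝ)
    (R : V → V → V → V) (c : ℝ) : Prop extends IsAlmostContact B φ ξ η where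
  add_mid : ∀ u v v' w, R u (v + v') w = R u v w + R u v' w
  smul_mid : ∀ u (a : ℝ) v w, R u (a • v) w = a • R u v w
  add_right : ∀ u v w w', R u v (w + w') = R u v w + R u v w'
  smul_right : ∀ u v (a : ℝ) w, R u v (a • w) = a • R u v w
  antisymm : ∀ u v w, R u v w = -R v u w
  bianchi : ∀ u v w, R u v w + R v w u + R w u v = 0
  skew : ∀ u v w z, B (R u v w) z = -B w (R u v z)
  ricci : ∀ u v w, R u v (φ w) - φ (R u v w)
    = B u w • φ v - B v w • φ u + B (φ u) w • v - B (φ v) w • u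
  sectional : ∀ u, B u u = 1 → B u ξ = 0 → B (R u (φ u) (φ u)) u = c

namespace IsSasakianCurvature

variable {B : V →L[ℝ] V →L[ℝ] ℝ} {φ : V →L[ℝ] V} {ξ : V} {η : V →L[ℝ] ℝ}
  {R : V → V → V → V} {c : ℝ} (h : IsSasakianCurvature B φ ξ η R c)

include h

theorem add_left (u u' v w : V) : R (u + u') v w = R u v w + R u' v w := by
  rw [h.antisymm, h.add_mid, h.antisymm u, h.antisymm u']; abel

theorem smul_left (a : ℝ) (u v w : V) : R (a • u) v w = a • R u v w := by
  rw [h.antisymm, h.smul_mid, h.antisymm u, smul_neg]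

/-- The Ricci identity at w = ξ determines the φ-image of R(u, v)ξ, and skewness makes its
η-component 0. Together these determine a vector. -/
theorem apply_ξ (u v : V) : R u v ξ = η v • u - η u • v := by
  have h1 := h.ricci u v ξ
  have h0 : R u v 0 = 0 := by simpa using h.smul_right u v 0 0
  rw [h.φ_ξ, h0] at h1
  simp only [← h.η_eq, h.η_φ, zero_smul, add_zero, sub_zero, zero_sub] at h1
  have h2 : η (R u v ξ) = 0 := by
    have := h.skew u v ξ ξ
    rw [h.symm ξ] at this
    rw [h.η_eq]; linarith
  rw [← sub_eq_zero]
  apply h.eq_zero_of_φ_eq_zero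
  · rw [neg_eq_iff_eq_neg] at h1
    rw [map_sub, h1]; simp
  · rw [map_sub, h2]; simp [mul_comm]

theorem inner_antisymm (u v w z : V) : B (R u v w) z = -B (R v u w) z := by
  rw [h.antisymm]; simp

theorem inner_skew (u v w z : V) : B (R u v w) z = -B (R u v z) w := by
  rw [h.skew, h.symm]

/-- The classical octahedron argument: the Bianchi identity at the four cyclic rotations of (a, b,
x, d), combined with the two skew-symmetries. -/
theorem pair_symm (a b x d : V) : B (R a b x) d = B (R x d a) b := by
  have bi : ∀ u v w z, B (R u v w) z + B (R v w u) z + B (R w u v) z = 0 := fun u v w z => by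
    have := congrArg (fun x => B x z) (h.bianchi u v w)
    simpa using this
  have b1 := bi a b x d
  have b2 := bi b x d a
  have b3 := bi x d a b
  have b4 := bi d a b x
  have := h.inner_skew b x d a
  have := h.inner_skew d b x a
  have := h.inner_antisymm d b a x
  have := h.inner_skew x d a b
  have := h.inner_skew x d b a
  have := h.inner_skew x a d b
  have := h.inner_antisymm x a b d
  have := h.inner_skew a x b d
  have := h.inner_skew d a b x
  have := h.inner_antisymm d a x b
  have := h.inner_skew a b d x
  have := h.inner_skew a b x d
  have := h.inner_antisymm b d x a
  have := h.inner_skew b d a x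
  have := h.inner_antisymm x b d a
  have := h.inner_antisymm b x a d
  have := h.inner_skew b x a d
  have := h.inner_antisymm a x d b
  have := h.inner_skew a d x b
  have := h.inner_antisymm d a b x
  linarith

theorem apply_ξ_left (v w : V) : R ξ v w = B v w • ξ - η w • v := by
  refine h.ext_inner fun z => ?_
  rw [h.pair_symm, h.apply_ξ]
  simp only [map_sub, map_smul, sub_apply, smul_apply, smul_eq_mul, h.symm ξ z, ← h.η_eq,
    h.symm w v, h.symm z v]
  ring

theorem sectional_homogeneous {u : V} (hu : η u = 0) :
    B (R u (φ u) (φ u)) u = c * (B u u) ^ 2 := by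
  by_cases h0 : u = 0
  · subst h0; simp
  have hp := h.pos u h0
  set l := √(B u u) with hl
  have hl0 : l ≠ 0 := (Real.sqrt_pos.2 hp).ne'
  have hl2 : l ^ 2 = B u u := Real.sq_sqrt hp.le
  have h1 := h.sectional (l⁻¹ • u) (by simp [← hl2]; field_simp) (by simp [← h.η_eq, hu])
  simp only [map_smul, h.smul_left, h.smul_mid, h.smul_right, smul_apply, smul_eq_mul] at h1
  rw [← h1, ← hl2]; field_simp

/-- Polarisation: u + tw is put into the quartic identity `sectional_homogeneous` and the
coefficients of t are compared. -/
theorem inner_curvature_φ {u w : V} (hu : η u = 0) (hw : η w = 0) :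
    B (R u (φ u) (φ u)) w = c * B u u * B u w := by
  have hq : ∀ t : ℝ, B (R u (φ u) (φ u)) u
      + t * (B (R w (φ u) (φ u)) u + B (R u (φ w) (φ u)) u + B (R u (φ u) (φ w)) u
        + B (R u (φ u) (φ u)) w)
      + t ^ 2 * (B (R w (φ w) (φ u)) u + B (R w (φ u) (φ w)) u + B (R w (φ u) (φ u)) w
        + B (R u (φ w) (φ w)) u + B (R u (φ w) (φ u)) w + B (R u (φ u) (φ w)) w)
      + t ^ 3 * (B (R w (φ w) (φ w)) u + B (R w (φ w) (φ u)) w + B (R w (φ u) (φ w)) w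
        + B (R u (φ w) (φ w)) w) + t ^ 4 * B (R w (φ w) (φ w)) w
      = c * (B u u + 2 * t * B u w + t ^ 2 * B w w) ^ 2 := by
    intro t
    have := h.sectional_homogeneous (u := u + t • w) (by simp [hu, hw])
    simp only [map_add, map_smul, h.add_left, h.smul_left, h.add_mid, h.smul_mid, h.add_right,
      h.smul_right, smul_apply, smul_eq_mul, add_apply, h.symm w u] at this
    linarith
  -- The four terms in the coefficient of t coincide: `e1` and `e2` by pair symmetry, `e3` by the
  -- Ricci identity, whose right side is orthogonal to u here.
  have e1 : B (R w (φ u) (φ u)) u = B (R u (φ u) (φ u)) w := by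
    rw [h.pair_symm, h.inner_antisymm, h.inner_skew, neg_neg]
  have e2 : B (R u (φ w) (φ u)) u = B (R u (φ u) (φ w)) u := by
    rw [h.pair_symm, h.inner_antisymm, h.inner_skew, neg_neg]
  have e3 : B (R u (φ u) (φ w)) u = B (R u (φ u) (φ u)) w := by
    have h1 := congrArg (fun x => B x u) (h.ricci u (φ u) w)
    simp only [map_add, map_sub, map_smul, sub_apply, add_apply, smul_apply, smul_eq_mul,
      h.φ_skew (R u (φ u) w), h.φ_sq, hu, zero_smul, add_zero, map_neg, neg_apply] at h1
    rw [h.inner_skew u (φ u) (φ u) w]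
    linarith
  -- The differences of the values at ±1 and at ±2 remove the even coefficients; combining them
  -- removes the cubic one.
  have a1 := hq 1
  have a2 := hq (-1)
  have a3 := hq 2
  have a4 := hq (-2)
  linarith

/-- Every test vector splits into its horizontal part, covered by `inner_curvature_φ`, and a
multiple of ξ, on which `apply_ξ` gives 0. -/
theorem curvature_φ {u : V} (hu : η u = 0) : R u (φ u) (φ u) = (c * B u u) • u := by
  refine h.ext_inner fun z => ?_
  have h1 := h.inner_curvature_φ hu (w := z - η z • ξ) (by simp [h.η_ξ])
  have h2 : B (R u (φ u) (φ u)) ξ = 0 := by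
    rw [h.skew, h.apply_ξ, hu, h.η_φ]; simp
  simp only [map_sub, map_smul, h2, ← h.η_eq, hu, smul_zero, sub_zero] at h1
  rw [h1]; simp

/-- The curvature term in the bitension field of a curve with `∇_T T ∥ φ T`. -/
theorem curvature_tangent {T : V} (hT : B T T = 1) :
    R T (φ T) T = -(1 + (c - 1) * (1 - η T ^ 2)) • φ T := by
  -- T is split into its ξ-component and its horizontal part u. Of the four resulting terms only
  -- R(ξ, φu)ξ = -φu and R(u, φu)u survive.
  set u := T - η T • ξ with hu
  have hu0 : η u = 0 := by simp [hu, h.η_ξ]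
  have hφ : φ T = φ u := by simp [hu, h.φ_ξ]
  have hTu : T = η T • ξ + u := by simp [hu]
  have hB : B u u = 1 - η T ^ 2 := by
    simp only [hu, map_sub, map_smul, sub_apply, smul_apply, smul_eq_mul, hT, h.symm ξ T,
      ← h.η_eq, h.η_ξ]
    ring
  have h1 : R u (φ u) u = -(c * B u u) • φ u := by
    -- `curvature_φ` is applied to φu, because φ(φu) = -u turns it into a statement about R(φu, u)u.
    have := h.curvature_φ (h.η_φ u)
    rw [h.φ_sq, hu0, zero_smul, add_zero] at this
    have hneg : ∀ a b : V, R a (-b) (-u) = R a b u := by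
      intro a b
      have e1 := h.smul_mid a (-1) b (-u)
      have e2 := h.smul_right a b (-1) u
      simp only [neg_smul, one_smul] at e1 e2
      rw [e1, e2, neg_neg]
    rw [hneg, h.antisymm, h.inner_φ, hu0, mul_zero, sub_zero] at this
    rw [neg_eq_iff_eq_neg] at this
    rw [this, neg_smul]
  have h2 : R T (φ u) T = η T ^ 2 • R ξ (φ u) ξ + η T • R ξ (φ u) u + η T • R u (φ u) ξ
      + R u (φ u) u := by
    conv_lhs => rw [hTu]
    simp only [h.add_left, h.add_right, h.smul_left, h.smul_right]
    module
  rw [hφ, h2, h1, h.apply_ξ_left, h.apply_ξ_left, h.apply_ξ, hB, hu0, h.η_φ, h.η_ξ,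
    h.symm (φ u) u, h.inner_φ_self, h.symm (φ u) ξ, h.symm ξ, ← h.η_eq, h.η_φ]
  module

end IsSasakianCurvature

end Algebra

/-! ### Covariant derivatives of ξ and φ, and the Ricci identity, in coordinates -/

section LocalSasakian

open scoped Topology

variable {E : Type*} [NormedAddCommGroup E] [NormedSpace ℝ E]

/-- A Sasakian structure on an open subset of a vector space. -/
structure IsLocalSasakian (U : Set E) (G : E → E →L[ℝ] E →L[ℝ] ℝ) (Φ : E → E →L[ℝ] E) (Ξ : E → E)
    (H : E → E →L[ℝ] ℝ) : Prop extends IsLocalMetric U G where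
  smooth_end : ContDiffOn ℝ ∞ Φ U
  smooth_field : ContDiffOn ℝ ∞ Ξ U
  almostContact : ∀ y ∈ U, IsAlmostContact (G y) (Φ y) (Ξ y) (H y)
  covDerivEnd : ∀ y ∈ U, ∀ u w, localCovDerivEnd G Φ y u w = G y u w • Ξ y - H y w • u

theorem localCovDeriv_end {G : E → E →L[ℝ] E →L[ℝ] ℝ} {Φ : E → E →L[ℝ] E} {A : E → E} {y : E}
    (hΦ : DifferentiableAt ℝ Φ y) (hA : DifferentiableAt ℝ A y) (u : E) :
    localCovDeriv G (fun z => Φ z (A z)) y u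
      = localCovDerivEnd G Φ y u (A y) + Φ y (localCovDeriv G A y u) := by
  simp only [localCovDeriv, localCovDerivEnd]
  rw [(hΦ.hasFDerivAt.clm_apply hA.hasFDerivAt).fderiv]
  simp only [add_apply, ContinuousLinearMap.comp_apply, ContinuousLinearMap.flip_apply, map_add]
  abel

theorem localCovDeriv_smul {G : E → E →L[ℝ] E →L[ℝ] ℝ} {a : E → ℝ} {A : E → E} {y : E}
    (ha : DifferentiableAt ℝ a y) (hA : DifferentiableAt ℝ A y) (u : E) :
    localCovDeriv G (fun z => a z • A z) y u
      = fderiv ℝ a y u • A y + a y • localCovDeriv G A y u := by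
  simp only [localCovDeriv, christoffel_smul_right]
  rw [fderiv_fun_smul ha hA]
  simp only [add_apply, smul_apply, ContinuousLinearMap.smulRight_apply]
  module

theorem localCovDeriv_add {G : E → E →L[ℝ] E →L[ℝ] ℝ} {A B : E → E} {y : E}
    (hA : DifferentiableAt ℝ A y) (hB : DifferentiableAt ℝ B y) (u : E) :
    localCovDeriv G (fun z => A z + B z) y u = localCovDeriv G A y u + localCovDeriv G B y u := by
  simp only [localCovDeriv, christoffel_add_right]
  rw [fderiv_fun_add hA hB, add_apply]
  abel

theorem localCovDeriv_congr {G : E → E →L[ℝ] E →L[ℝ] ℝ} {A B : E → E} {y : E}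
    (h : A =ᶠ[𝓝 y] B) (u : E) : localCovDeriv G A y u = localCovDeriv G B y u := by
  simp only [localCovDeriv, h.fderiv_eq, h.eq_of_nhds]

namespace IsLocalSasakian

variable {U : Set E} {G : E → E →L[ℝ] E →L[ℝ] ℝ} {Φ : E → E →L[ℝ] E} {Ξ : E → E}
    {H : E → E →L[ℝ] ℝ} (h : IsLocalSasakian U G Φ Ξ H) {y : E} (hy : y ∈ U)

include h hy

theorem contDiffAt_end : ContDiffAt ℝ ∞ Φ y := h.smooth_end.contDiffAt (h.mem_nhds hy)

theorem differentiableAt_end : DifferentiableAt ℝ Φ y :=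
  (h.contDiffAt_end hy).differentiableAt (by simp)

theorem differentiableAt_field : DifferentiableAt ℝ Ξ y :=
  (h.smooth_field.contDiffAt (h.mem_nhds hy)).differentiableAt (by simp)

variable [FiniteDimensional ℝ E]

/-- `∇_u ξ = -φ u`. -/
theorem localCovDeriv_field (u : E) : localCovDeriv G Ξ y u = -Φ y u := by
  have hc := h.almostContact y hy
  -- Differentiating φξ = 0 gives φ(∇_u ξ) = u - η(u)ξ = -φ²u, and differentiating g(ξ, ξ) = 1 gives
  -- η(∇_u ξ) = 0. A vector is determined by its images under φ and η.
  have h1 := localCovDeriv_end (G := G) (h.differentiableAt_end hy) (h.differentiableAt_field hy) u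
  have h2 : (fun z => Φ z (Ξ z)) =ᶠ[𝓝 y] fun _ => 0 := by
    filter_upwards [h.mem_nhds hy] with z hz using (h.almostContact z hz).φ_ξ
  have h3 : localCovDeriv G (fun _ : E => (0 : E)) y u = 0 := by
    have := christoffel_smul_right G y u 0 0
    simp only [zero_smul] at this
    simp [localCovDeriv, this]
  rw [localCovDeriv_congr h2, h3, h.covDerivEnd y hy, hc.η_ξ, ← hc.η_eq, one_smul] at h1
  have h4 : (fun z => G z (Ξ z) (Ξ z)) =ᶠ[𝓝 y] fun _ => (1 : ℝ) := by
    filter_upwards [h.mem_nhds hy] with z hz using (h.almostContact z hz).inner_ξ_ξ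
  have h5 := h.fderiv_inner hy (h.differentiableAt_field hy) (h.differentiableAt_field hy) u
  rw [h4.fderiv_eq, hc.symm (Ξ y), ← hc.η_eq] at h5
  simp only [fderiv_fun_const, Pi.zero_apply, zero_apply] at h5
  have h6 : H y (localCovDeriv G Ξ y u) = 0 := by linarith
  rw [← sub_eq_zero, sub_neg_eq_add]
  apply hc.eq_zero_of_φ_eq_zero
  · rw [map_add, hc.φ_sq, h1]; abel
  · rw [map_add, h6, hc.η_φ, add_zero]

set_option synthInstance.maxHeartbeats 100000 in
/-- The Ricci identity for `φ`. -/
theorem localCurvature_end (u v w : E) :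
    localCurvature G y u v (Φ y w) - Φ y (localCurvature G y u v w)
      = G y u w • Φ y v - G y v w • Φ y u + G y (Φ y u) w • v - G y (Φ y v) w • u := by
  have hX : ContDiffAt ℝ ∞ (fun z => Φ z w) y := (h.contDiffAt_end hy).clm_apply contDiffAt_const
  have hΦd := h.differentiableAt_end hy
  have hGd := h.differentiableAt hy
  have hΞd := h.differentiableAt_field hy
  have hc : ∀ a : E, DifferentiableAt ℝ (fun _ : E => a) y := fun a => differentiableAt_const a
  -- The commutator of covariant derivatives is applied to the field z ↦ `Φ z w` with w constant. In
  -- `e`, η(w) is written as g(w, ξ), so that metric compatibility and ∇ξ = -φ suffice to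
  -- differentiate it.
  have key : ∀ u v, localCovDeriv G (fun z => localCovDeriv G (fun z => Φ z w) z v) y u
      = localCovDerivEnd G Φ y u (christoffel G y v w)
        + Φ y (localCovDeriv G (fun z => christoffel G z v w) y u)
        + ((G y (christoffel G y u v) w + G y v (christoffel G y u w)) • Ξ y - G y v w • Φ y u)
        - ((G y (christoffel G y u w) (Ξ y) - G y w (Φ y u)) • v
          + G y w (Ξ y) • christoffel G y u v) := by
    intro u v
    have e : (fun z => localCovDeriv G (fun z => Φ z w) z v) =ᶠ[𝓝 y]
        fun z => (Φ z (christoffel G z v w) + G z v w • Ξ z) + (-G z w (Ξ z)) • v := by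
      filter_upwards [h.mem_nhds hy] with z hz
      rw [localCovDeriv_end (h.differentiableAt_end hz) (differentiableAt_const w),
        h.covDerivEnd z hz, (h.almostContact z hz).η_eq]
      simp only [localCovDeriv, fderiv_fun_const, Pi.zero_apply, zero_apply, zero_add]
      module
    have d1 := h.differentiableAt_christoffel hy v w
    have d2 : DifferentiableAt ℝ (fun z => G z v w) y := (hGd.clm_apply (hc v)).clm_apply (hc w)
    have d3 : DifferentiableAt ℝ (fun z => G z w (Ξ z)) y := (hGd.clm_apply (hc w)).clm_apply hΞd
    have d4 : DifferentiableAt ℝ (fun z => Φ z (christoffel G z v w)) y := hΦd.clm_apply d1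
    have d5 : DifferentiableAt ℝ (fun z => G z v w • Ξ z) y := d2.smul hΞd
    have d6 : DifferentiableAt ℝ (fun z => -G z w (Ξ z)) y := d3.neg
    have d7 : DifferentiableAt ℝ (fun z => (-G z w (Ξ z)) • v) y := d6.smul (hc v)
    rw [localCovDeriv_congr e, localCovDeriv_add (d4.fun_add d5) d7, localCovDeriv_add d4 d5,
      localCovDeriv_end hΦd d1, localCovDeriv_smul d2 hΞd, localCovDeriv_smul d6 (hc v),
      fderiv_fun_neg, neg_apply, h.fderiv_inner hy (hc v) (hc w), h.fderiv_inner hy (hc w) hΞd,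
      h.localCovDeriv_field hy]
    simp only [localCovDeriv, fderiv_fun_const, Pi.zero_apply, zero_apply, zero_add, map_neg]
    module
  have hs := (h.almostContact y hy)
  rw [h.localCurvature_eq_commutator hy hX, key, key, localCurvature_eq_localCovDeriv, map_sub,
    h.covDerivEnd y hy, h.covDerivEnd y hy, hs.η_eq, hs.η_eq, h.christoffel_symm hy v u,
    hs.symm w (Φ y u), hs.symm w (Φ y v)]
  module

theorem isSasakianCurvature {c : ℝ}
    (hsec : ∀ u, G y u u = 1 → G y u (Ξ y) = 0 →
      G y (localCurvature G y u (Φ y u) (Φ y u)) u = c) :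
    IsSasakianCurvature (G y) (Φ y) (Ξ y) (H y) (localCurvature G y) c where
  toIsAlmostContact := h.almostContact y hy
  add_mid := h.localCurvature_add_mid hy
  smul_mid := h.localCurvature_smul_mid hy
  add_right := h.localCurvature_add_right hy
  smul_right := h.localCurvature_smul_right hy
  antisymm := localCurvature_antisymm G y
  bianchi := h.localCurvature_bianchi hy
  skew := h.localCurvature_skew hy
  ricci := h.localCurvature_end hy
  sectional := hsec

end IsLocalSasakian

end LocalSasakian

/-! ### Passage between tangent vectors and their components in a chart -/

section Charts

open scoped Topology

variable {m : ℕ} {M : Type*} [TopologicalSpace M] [ChartedSpace (EuclideanSpace ℝ (Fin m)) M]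
  [IsManifold (𝓡 m) ∞ M]

theorem mem_baseSet_of_mem_source {p x : M} (hx : x ∈ (extChartAt (𝓡 m) p).source) :
    x ∈ (trivializationAt (EuclideanSpace ℝ (Fin m))
      (fun x : M => TangentSpace (𝓡 m) x) p).baseSet := by
  rw [extChartAt_source] at hx
  exact hx

theorem ofCoord_toCoord {p x : M} (hx : x ∈ (extChartAt (𝓡 m) p).source)
    (v : TangentSpace (𝓡 m) x) : ofCoord p x (toCoord p x v) = v :=
  Bundle.Trivialization.symmL_continuousLinearMapAt _ (mem_baseSet_of_mem_source hx) v

theorem toCoord_ofCoord {p x : M} (hx : x ∈ (extChartAt (𝓡 m) p).source)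
    (v : EuclideanSpace ℝ (Fin m)) : toCoord p x (ofCoord p x v) = v :=
  Bundle.Trivialization.continuousLinearMapAt_symmL _ (mem_baseSet_of_mem_source hx) v

theorem coordMetric_apply (g : Metric m M) (p : M) (y u v : EuclideanSpace ℝ (Fin m)) :
    coordMetric g p y u v = g.inner ((extChartAt (𝓡 m) p).symm y)
      (ofCoord p ((extChartAt (𝓡 m) p).symm y) u) (ofCoord p ((extChartAt (𝓡 m) p).symm y) v) :=
  rfl

theorem coordMetric_toCoord (g : Metric m M) {p x : M} (hx : x ∈ (extChartAt (𝓡 m) p).source)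
    (u v : TangentSpace (𝓡 m) x) :
    coordMetric g p (extChartAt (𝓡 m) p x) (toCoord p x u) (toCoord p x v) = g.inner x u v := by
  rw [coordMetric_apply, (extChartAt (𝓡 m) p).left_inv hx, ofCoord_toCoord hx, ofCoord_toCoord hx]

theorem coordEnd_toCoord (φ : ∀ x : M, TangentSpace (𝓡 m) x →L[ℝ] TangentSpace (𝓡 m) x) {p x : M}
    (hx : x ∈ (extChartAt (𝓡 m) p).source) (u : TangentSpace (𝓡 m) x) :
    coordEnd φ p (extChartAt (𝓡 m) p x) (toCoord p x u) = toCoord p x (φ x u) := by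
  simp only [coordEnd, ContinuousLinearMap.comp_apply]
  rw [(extChartAt (𝓡 m) p).left_inv hx, ofCoord_toCoord hx]

theorem coordField_eq (ξ : ∀ x : M, TangentSpace (𝓡 m) x) {p x : M}
    (hx : x ∈ (extChartAt (𝓡 m) p).source) :
    coordField ξ p (extChartAt (𝓡 m) p x) = toCoord p x (ξ x) := by
  simp only [coordField]
  rw [(extChartAt (𝓡 m) p).left_inv hx]

theorem contMDiffOn_ofCoord (p : M) (u : EuclideanSpace ℝ (Fin m)) :
    ContMDiffOn (𝓡 m) (𝓡 m).tangent ∞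
      (fun x => (⟨x, ofCoord p x u⟩ : TangentBundle (𝓡 m) M)) (extChartAt (𝓡 m) p).source := by
  have h := Bundle.Trivialization.contMDiffOn_symm (IB := 𝓡 m) (n := ∞)
    (trivializationAt (EuclideanSpace ℝ (Fin m)) (fun x : M => TangentSpace (𝓡 m) x) p)
  have h2 : ContMDiffOn (𝓡 m) ((𝓡 m).prod 𝓘(ℝ, EuclideanSpace ℝ (Fin m))) ∞
      (fun x : M => (x, u)) (extChartAt (𝓡 m) p).source := contMDiffOn_id.prodMk contMDiffOn_const
  refine (h.comp h2 fun x hx => ?_).congr fun x hx => ?_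
  · rw [Bundle.Trivialization.target_eq]
    exact ⟨mem_baseSet_of_mem_source hx, Set.mem_univ _⟩
  · exact (congrArg (fun w => (⟨x, w⟩ : TangentBundle (𝓡 m) M))
      (Bundle.Trivialization.symmL_apply _ (mem_baseSet_of_mem_source hx) u)).trans
      (Bundle.Trivialization.mk_symm _ (mem_baseSet_of_mem_source hx) u)

theorem contDiffOn_coordMetric (g : Metric m M) (p : M) :
    ContDiffOn ℝ ∞ (coordMetric g p) (extChartAt (𝓡 m) p).target := by
  refine contDiffOn_clm_apply.2 fun u => contDiffOn_clm_apply.2 fun v => ?_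
  have h : ContMDiffOn (𝓡 m) 𝓘(ℝ, ℝ) ∞ (fun x => g.inner x (ofCoord p x u) (ofCoord p x v))
      (extChartAt (𝓡 m) p).source := by
    have hu := contMDiffOn_ofCoord p u
    have hv := contMDiffOn_ofCoord p v
    have := ContMDiffOn.clm_bundle_apply₂ (F₁ := EuclideanSpace ℝ (Fin m))
      (F₂ := EuclideanSpace ℝ (Fin m)) (F₃ := ℝ) (E₃ := Bundle.Trivial M ℝ) (b := fun x : M => x)
      (g.contMDiff.contMDiffOn (s := (extChartAt (𝓡 m) p).source)) hu hv
    intro x hx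
    have := this x hx
    simp only [Bundle.contMDiffWithinAt_totalSpace] at this
    exact this.2
  rw [← contMDiffOn_iff_contDiffOn]
  exact h.comp (contMDiffOn_extChartAt_symm p) fun y hy => (extChartAt (𝓡 m) p).map_target hy

theorem isLocalMetric_coordMetric (g : Metric m M) (p : M) :
    IsLocalMetric (extChartAt (𝓡 m) p).target (coordMetric g p) where
  isOpen := isOpen_extChartAt_target p
  smooth := contDiffOn_coordMetric g p
  symm y _ u v := g.symm _ _ _
  pos y hy v hv := by
    refine g.pos _ _ fun h0 => hv ?_
    exact (toCoord_ofCoord ((extChartAt (𝓡 m) p).map_target hy) v).symm.trans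
      ((congrArg _ h0).trans (map_zero _))

/-- Over the chart domain the trivialisation of the tangent bundle is the differential of the chart,
so this is the chain rule. -/
theorem toCoord_velocity {γ : ℝ → M} {t : ℝ} {p : M}
    (hγ : MDifferentiableAt 𝓘(ℝ, ℝ) (𝓡 m) γ t) (ht : γ t ∈ (extChartAt (𝓡 m) p).source) :
    HasDerivAt (fun s => extChartAt (𝓡 m) p (γ s)) (toCoord p (γ t) (velocity γ t)) t := by
  rw [extChartAt_source] at ht
  have h1 := (mdifferentiableAt_extChartAt (I := 𝓡 m) ht).hasMFDerivAt
  have h2 : HasFDerivAt (fun s => extChartAt (𝓡 m) p (γ s))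
      ((mfderiv (𝓡 m) 𝓘(ℝ, EuclideanSpace ℝ (Fin m)) (extChartAt (𝓡 m) p) (γ t) ∘L
        mfderiv 𝓘(ℝ, ℝ) (𝓡 m) γ t : ℝ →L[ℝ] EuclideanSpace ℝ (Fin m))) t :=
    (h1.comp t hγ.hasMFDerivAt).hasFDerivAt
  have h3 := congrArg (fun L : TangentSpace (𝓡 m) (γ t) →L[ℝ] EuclideanSpace ℝ (Fin m) =>
    L (velocity γ t)) (TangentBundle.continuousLinearMapAt_trivializationAt ht)
  exact h2.hasDerivAt.congr_deriv h3.symm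

end Charts

/-! ### Calculus of covariant derivatives along a curve -/

section CovariantDerivative

open scoped Topology

variable {m : ℕ} {M : Type*} [TopologicalSpace M] [ChartedSpace (EuclideanSpace ℝ (Fin m)) M]
  [IsManifold (𝓡 m) ∞ M]

/-- The field `V` along `γ` is differentiable at `t` with covariant derivative `V'`. -/
structure HasCovDerivAt (g : Metric m M) (γ : ℝ → M) (V : ∀ t, TangentSpace (𝓡 m) (γ t)) (t : ℝ)
    (V' : TangentSpace (𝓡 m) (γ t)) : Prop where
  curve : MDifferentiableAt 𝓘(ℝ, ℝ) (𝓡 m) γ t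
  differentiableAt : DifferentiableAt ℝ (fun s => toCoord (γ t) (γ s) (V s)) t
  covDeriv_eq : covDeriv g γ V t = V'

omit [IsManifold (𝓡 m) ∞ M] in
theorem eventually_mem_source {γ : ℝ → M} {t : ℝ} (hγ : MDifferentiableAt 𝓘(ℝ, ℝ) (𝓡 m) γ t) :
    ∀ᶠ s in 𝓝 t, γ s ∈ (extChartAt (𝓡 m) (γ t)).source :=
  hγ.continuousAt (extChartAt_source_mem_nhds (I := 𝓡 m) (γ t))

theorem hasDerivAt_extChartAt {γ : ℝ → M} {t : ℝ} (hγ : MDifferentiableAt 𝓘(ℝ, ℝ) (𝓡 m) γ t) :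
    HasDerivAt (fun s => extChartAt (𝓡 m) (γ t) (γ s)) (toCoord (γ t) (γ t) (velocity γ t)) t :=
  toCoord_velocity hγ (mem_extChartAt_source (γ t))

namespace HasCovDerivAt

variable {g : Metric m M} {γ : ℝ → M} {V W : ∀ t, TangentSpace (𝓡 m) (γ t)} {t : ℝ}
  {V' W' : TangentSpace (𝓡 m) (γ t)}

/-- The criterion behind the product rules below: only the germ at t of the components in the chart
at `γ t` matters. -/
theorem of_coord (hγ : MDifferentiableAt 𝓘(ℝ, ℝ) (𝓡 m) γ t) {A : ℝ → EuclideanSpace ℝ (Fin m)}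
    {a : EuclideanSpace ℝ (Fin m)} (hA : HasDerivAt A a t)
    (hVA : ∀ᶠ s in 𝓝 t, toCoord (γ t) (γ s) (V s) = A s)
    (ha : a + christoffel (coordMetric g (γ t)) (extChartAt (𝓡 m) (γ t) (γ t))
      (toCoord (γ t) (γ t) (velocity γ t)) (A t) = toCoord (γ t) (γ t) V') :
    HasCovDerivAt g γ V t V' := by
  have h1 : HasDerivAt (fun s => toCoord (γ t) (γ s) (V s)) a t := hA.congr_of_eventuallyEq hVA
  refine ⟨hγ, h1.differentiableAt, ?_⟩
  have h2 : toCoord (γ t) (γ t) (V t) = A t := hVA.self_of_nhds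
  simp only [covDeriv]
  rw [h1.deriv, h2, ha]
  exact ofCoord_toCoord (mem_extChartAt_source (γ t)) V'

theorem hasDerivAt_toCoord (hV : HasCovDerivAt g γ V t V') :
    HasDerivAt (fun s => toCoord (γ t) (γ s) (V s)) (toCoord (γ t) (γ t) V'
      - christoffel (coordMetric g (γ t)) (extChartAt (𝓡 m) (γ t) (γ t))
      (toCoord (γ t) (γ t) (velocity γ t)) (toCoord (γ t) (γ t) (V t))) t := by
  refine hV.differentiableAt.hasDerivAt.congr_deriv ?_
  rw [← hV.covDeriv_eq, covDeriv]
  exact (sub_eq_of_eq_add (toCoord_ofCoord (mem_extChartAt_source (γ t)) _)).symm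

theorem congr_of_eventuallyEq (hV : HasCovDerivAt g γ V t V') (h : ∀ᶠ s in 𝓝 t, W s = V s) :
    HasCovDerivAt g γ W t V' := by
  refine of_coord hV.curve hV.hasDerivAt_toCoord ?_ (by abel)
  filter_upwards [h] with s hs
  rw [hs]

theorem congr_right (hV : HasCovDerivAt g γ V t V') (h : V' = W') : HasCovDerivAt g γ V t W' :=
  h ▸ hV

theorem unique (hV : HasCovDerivAt g γ V t V') (hW : HasCovDerivAt g γ V t W') : V' = W' :=
  hV.covDeriv_eq.symm.trans hW.covDeriv_eq

protected theorem add (hV : HasCovDerivAt g γ V t V') (hW : HasCovDerivAt g γ W t W') :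
    HasCovDerivAt g γ (fun s => V s + W s) t (V' + W') := by
  refine of_coord hV.curve (hV.hasDerivAt_toCoord.add hW.hasDerivAt_toCoord)
    (Filter.Eventually.of_forall fun s => by simp) ?_
  simp only [Pi.add_apply, christoffel_add_right, map_add]
  abel

protected theorem smul {a : ℝ → ℝ} {a' : ℝ} (ha : HasDerivAt a a' t)
    (hV : HasCovDerivAt g γ V t V') :
    HasCovDerivAt g γ (fun s => a s • V s) t (a' • V t + a t • V') := by
  refine of_coord hV.curve (ha.smul hV.hasDerivAt_toCoord)
    (Filter.Eventually.of_forall fun s => by simp) ?_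
  simp only [Pi.smul_apply', christoffel_smul_right, map_add, map_smul, smul_sub]
  abel

protected theorem neg (hV : HasCovDerivAt g γ V t V') :
    HasCovDerivAt g γ (fun s => -V s) t (-V') := by
  simpa using HasCovDerivAt.smul (hasDerivAt_const t (-1 : ℝ)) hV

protected theorem sub (hV : HasCovDerivAt g γ V t V') (hW : HasCovDerivAt g γ W t W') :
    HasCovDerivAt g γ (fun s => V s - W s) t (V' - W') := by
  simpa only [sub_eq_add_neg] using hV.add hW.neg

/-- Near t the curve stays in the chart at `γ t`, where metric compatibility in coordinates applies.
-/
theorem inner (hV : HasCovDerivAt g γ V t V') (hW : HasCovDerivAt g γ W t W') :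
    HasDerivAt (fun s => g.inner (γ s) (V s) (W s))
      (g.inner (γ t) V' (W t) + g.inner (γ t) (V t) W') t := by
  have hp := mem_extChartAt_source (I := 𝓡 m) (γ t)
  have hy := (extChartAt (𝓡 m) (γ t)).map_source hp
  have hG := isLocalMetric_coordMetric g (γ t)
  have h := hG.hasDerivAt_inner (hasDerivAt_extChartAt hV.curve) hV.hasDerivAt_toCoord
    hW.hasDerivAt_toCoord hy
  simp only [sub_add_cancel, coordMetric_toCoord g hp] at h
  refine h.congr_of_eventuallyEq ?_
  filter_upwards [eventually_mem_source hV.curve] with s hs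
  exact (coordMetric_toCoord g hs _ _).symm

end HasCovDerivAt

theorem SmoothAlong.hasCovDerivAt (g : Metric m M) {γ : ℝ → M} {J : Set ℝ} (hJ : IsOpen J) {t : ℝ}
    (ht : t ∈ J) {V : ∀ t, TangentSpace (𝓡 m) (γ t)} (hV : SmoothAlong J γ V) :
    HasCovDerivAt g γ V t (covDeriv g γ V t) := by
  have h := (hV t ht).contMDiffAt (hJ.mem_nhds ht)
  rw [Bundle.contMDiffAt_totalSpace] at h
  have hγ : MDifferentiableAt 𝓘(ℝ, ℝ) (𝓡 m) γ t := h.1.mdifferentiableAt (by simp)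
  refine ⟨hγ, ?_, rfl⟩
  refine (h.2.contDiffAt.differentiableAt (by simp)).congr_of_eventuallyEq ?_
  filter_upwards [eventually_mem_source hγ] with s hs
  simp only [toCoord]
  rw [Bundle.Trivialization.continuousLinearMapAt_apply,
    Bundle.Trivialization.coe_linearMapAt_of_mem _ (mem_baseSet_of_mem_source hs)]

end CovariantDerivative

/-! ### Sasakian identities along curves in the manifold -/

namespace ContactMetricStructure

variable {n : ℕ} {M : Type*} [TopologicalSpace M]
  [ChartedSpace (EuclideanSpace ℝ (Fin (2 * n + 1))) M] [IsManifold (𝓡 (2 * n + 1)) ∞ M]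
  (S : ContactMetricStructure n M)

theorem isAlmostContact (x : M) : IsAlmostContact (S.g.inner x) (S.φ x) (S.ξ x) (S.η x) where
  symm := S.g.symm x
  pos := S.g.pos x
  φ_sq := S.φ_sq x
  η_ξ := S.η_ξ x
  inner_φ := S.g_φ x

variable {S}

theorem IsSasakian.isLocalSasakian (hS : S.IsSasakian) (p : M) :
    IsLocalSasakian (extChartAt (𝓡 (2 * n + 1)) p).target (coordMetric S.g p) (coordEnd S.φ p)
      (coordField S.ξ p) (coordForm S.η p) where
  toIsLocalMetric := isLocalMetric_coordMetric S.g p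
  smooth_end := S.smooth_φ p
  smooth_field := S.smooth_ξ p
  covDerivEnd := hS p
  almostContact y hy := by
    have hx := (extChartAt (𝓡 (2 * n + 1)) p).map_target hy
    refine ⟨(isLocalMetric_coordMetric S.g p).symm y hy, (isLocalMetric_coordMetric S.g p).pos y hy,
      fun v => ?_, ?_, fun u v => ?_⟩
    · simp only [coordEnd, coordForm, coordField, ContinuousLinearMap.comp_apply]
      rw [ofCoord_toCoord hx, S.φ_sq]
      simp only [map_add, map_neg, map_smul, toCoord_ofCoord hx]
    · simp only [coordForm, coordField, ContinuousLinearMap.comp_apply]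
      rw [ofCoord_toCoord hx, S.η_ξ]
    · simp only [coordEnd, coordForm, coordMetric_apply, ContinuousLinearMap.comp_apply]
      rw [ofCoord_toCoord hx, ofCoord_toCoord hx, S.g_φ]

/-- The Leibniz rule for φ applied to V, with (∇_T φ)V replaced by its Sasakian value. -/
theorem IsSasakian.hasCovDerivAt_φ (hS : S.IsSasakian) {γ : ℝ → M}
    {V : ∀ t, TangentSpace (𝓡 (2 * n + 1)) (γ t)} {t : ℝ} {V' : TangentSpace (𝓡 (2 * n + 1)) (γ t)}
    (hV : HasCovDerivAt S.g γ V t V') :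
    HasCovDerivAt S.g γ (fun s => S.φ (γ s) (V s)) t
      (S.g.inner (γ t) (velocity γ t) (V t) • S.ξ (γ t) - S.η (γ t) (V t) • velocity γ t
        + S.φ (γ t) V') := by
  have hp := mem_extChartAt_source (I := 𝓡 (2 * n + 1)) (γ t)
  have hy := (extChartAt (𝓡 (2 * n + 1)) (γ t)).map_source hp
  have hG := hS.isLocalSasakian (γ t)
  have hd := (hG.differentiableAt_end hy).hasFDerivAt.comp_hasDerivAt t
    (hasDerivAt_extChartAt hV.curve)
  refine HasCovDerivAt.of_coord hV.curve (hd.clm_apply hV.hasDerivAt_toCoord) ?_ ?_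
  · filter_upwards [eventually_mem_source hV.curve] with s hs
    exact (coordEnd_toCoord S.φ hs _).symm
  · have h := hG.covDerivEnd _ hy (toCoord (γ t) (γ t) (velocity γ t)) (toCoord (γ t) (γ t) (V t))
    rw [coordMetric_toCoord S.g hp, coordField_eq S.ξ hp, (hG.almostContact _ hy).η_eq,
      coordField_eq S.ξ hp, coordMetric_toCoord S.g hp, ← (S.isAlmostContact (γ t)).η_eq,
      localCovDerivEnd] at h
    simp only [map_add, map_sub, map_smul, ← coordEnd_toCoord S.φ hp, ← h, Function.comp_apply]
    abel

theorem IsSasakian.hasCovDerivAt_ξ (hS : S.IsSasakian) {γ : ℝ → M} {t : ℝ}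
    (hγ : MDifferentiableAt 𝓘(ℝ, ℝ) (𝓡 (2 * n + 1)) γ t) :
    HasCovDerivAt S.g γ (fun s => S.ξ (γ s)) t (-S.φ (γ t) (velocity γ t)) := by
  have hp := mem_extChartAt_source (I := 𝓡 (2 * n + 1)) (γ t)
  have hy := (extChartAt (𝓡 (2 * n + 1)) (γ t)).map_source hp
  have hG := hS.isLocalSasakian (γ t)
  have hd := (hG.differentiableAt_field hy).hasFDerivAt.comp_hasDerivAt t (hasDerivAt_extChartAt hγ)
  refine HasCovDerivAt.of_coord hγ hd ?_ ?_
  · filter_upwards [eventually_mem_source hγ] with s hs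
    exact (coordField_eq S.ξ hs).symm
  · have h := hG.localCovDeriv_field hy (toCoord (γ t) (γ t) (velocity γ t))
    rw [map_neg, ← coordEnd_toCoord S.φ hp, ← h]
    rfl

/-- The factor `a` is present because the tension field of the curves in question is a multiple of
φT. -/
theorem IsSasakianSpaceForm.curvature_velocity {c : ℝ} (hS : S.IsSasakianSpaceForm c) (x : M)
    {T : TangentSpace (𝓡 (2 * n + 1)) x} (hT : S.g.inner x T T = 1) (a : ℝ) :
    curvature S.g x T (a • S.φ x T) T
      = -(1 + (c - 1) * (1 - S.η x T ^ 2)) • a • S.φ x T := by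
  have hp := mem_extChartAt_source (I := 𝓡 (2 * n + 1)) x
  have hy := (extChartAt (𝓡 (2 * n + 1)) x).map_source hp
  have hG := hS.1.isLocalSasakian x
  have key : ∀ v : EuclideanSpace ℝ (Fin (2 * n + 1)), toCoord x x (ofCoord x x v) = v :=
    toCoord_ofCoord hp
  have hR := hG.isSasakianCurvature hy (c := c) (fun u h1 h2 => by
    rw [← key u, coordMetric_toCoord S.g hp] at h1
    rw [← key u, coordField_eq S.ξ hp, coordMetric_toCoord S.g hp] at h2
    rw [← hS.2 x _ h1 h2, curvature, ← coordMetric_toCoord S.g hp, ← coordEnd_toCoord S.φ hp]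
    simp only [key])
  have h := hR.curvature_tangent (T := toCoord x x T) (by rw [coordMetric_toCoord S.g hp, hT])
  rw [coordEnd_toCoord S.φ hp, hR.η_eq, coordField_eq S.ξ hp, coordMetric_toCoord S.g hp,
    ← (S.isAlmostContact x).η_eq] at h
  rw [curvature, map_smul, hR.smul_mid, h]
  simp only [map_smul, ofCoord_toCoord hp]
  exact smul_comm _ _ _

end ContactMetricStructure

/-! ### Curves with ∇_T T parallel to φT -/

section SlantCurves

open scoped Topology

variable {n : ℕ} {M : Type*} [TopologicalSpace M]
  [ChartedSpace (EuclideanSpace ℝ (Fin (2 * n + 1))) M] [IsManifold (𝓡 (2 * n + 1)) ∞ M]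
  {S : ContactMetricStructure n M} {c : ℝ} {J : Set ℝ} {γ : ℝ → M} {r : ℕ}
  {E : ℕ → ∀ t, TangentSpace (𝓡 (2 * n + 1)) (γ t)} {κ : ℕ → ℝ → ℝ}

namespace IsFrenetCurve

variable (hγ : IsFrenetCurve S.g J γ r E κ) (hJ : IsOpen J) {t : ℝ} (ht : t ∈ J)

include hγ ht

theorem inner_velocity : S.g.inner (γ t) (velocity γ t) (velocity γ t) = 1 := by
  rw [← hγ.frame_one t ht]
  simpa using hγ.orthonormal t ht 1 1 le_rfl hγ.one_le le_rfl hγ.one_le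

theorem inner_frame_self {i : ℕ} (hi : 1 ≤ i) (hi' : i ≤ r) :
    S.g.inner (γ t) (E i t) (E i t) = 1 := by
  simpa using hγ.orthonormal t ht i i hi hi' hi hi'

theorem inner_velocity_frame {i : ℕ} (hi : 2 ≤ i) (hi' : i ≤ r) :
    S.g.inner (γ t) (velocity γ t) (E i t) = 0 := by
  rw [← hγ.frame_one t ht, hγ.orthonormal t ht 1 i le_rfl hγ.one_le (by omega) hi',
    if_neg (by omega)]

include hJ

theorem hasCovDerivAt_frame {i : ℕ} (hi : 1 ≤ i) (hi' : i ≤ r) :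
    HasCovDerivAt S.g γ (E i) t ((if 1 < i then -κ (i - 1) t • E (i - 1) t else 0)
        + (if i < r then κ i t • E (i + 1) t else 0)) :=
  (SmoothAlong.hasCovDerivAt S.g hJ ht (hγ.smooth_frame i hi hi')).congr_right
    (hγ.frenet t ht i hi hi')

theorem hasCovDerivAt_velocity :
    HasCovDerivAt S.g γ (velocity γ) t (if 1 < r then κ 1 t • E 2 t else 0) := by
  have h := (hγ.hasCovDerivAt_frame hJ ht le_rfl hγ.one_le)
  refine (h.congr_of_eventuallyEq ?_).congr_right (by simp)
  filter_upwards [hJ.mem_nhds ht] with s hs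
  exact (hγ.frame_one s hs).symm

theorem hasCovDerivAt_velocity_of_two_le (hr : 2 ≤ r) :
    HasCovDerivAt S.g γ (velocity γ) t (κ 1 t • E 2 t) :=
  (hγ.hasCovDerivAt_velocity hJ ht).congr_right (if_pos hr)

end IsFrenetCurve

/-- If `∇_T T ∥ φ T` then `η(T)` is constant. -/
theorem exists_η_velocity_eq (hS : S.IsSasakian) (hJ : IsOpen J) (hJc : IsPreconnected J)
    (hγ : IsFrenetCurve S.g J γ r E κ)
    (hpar : ∀ t ∈ J, Parallel (covDeriv S.g γ (velocity γ) t) (S.φ (γ t) (velocity γ t))) :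
    ∃ f : ℝ, ∀ t ∈ J, S.η (γ t) (velocity γ t) = f := by
  have key : ∀ t ∈ J, HasDerivAt (fun s => S.η (γ s) (velocity γ s)) 0 t := by
    intro t ht
    have hc := S.isAlmostContact (γ t)
    have hT := hγ.hasCovDerivAt_velocity hJ ht
    have h := hT.inner (hS.hasCovDerivAt_ξ hT.curve)
    rw [← hT.covDeriv_eq, map_neg, hc.inner_φ_self, neg_zero, add_zero, ← hc.η_eq] at h
    simp only [← (S.isAlmostContact (γ _)).η_eq] at h
    refine h.congr_deriv ?_
    have hTT := hγ.inner_velocity ht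
    -- The derivative is η(∇_T T). If either vector is a nonzero multiple of the other, or if ∇_T T
    -- = 0, then η ∘ φ = 0 makes it vanish. If φT = 0, then T = η(T)ξ with η(T) ≠ 0, and g(∇_T T, T)
    -- = 0 gives the same.
    rcases hpar t ht with ⟨a, ha⟩ | ⟨a, ha⟩
    · rw [ha, map_smul, hc.η_φ, smul_zero]
    · by_cases h0 : a = 0
      · have h1 : S.φ (γ t) (velocity γ t) = 0 := by rw [ha, h0, zero_smul]
        have h2 := hc.φ_sq (velocity γ t)
        rw [h1, map_zero, eq_comm, neg_add_eq_zero] at h2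
        have h3 := hT.inner hT
        have h4 : HasDerivAt (fun s => S.g.inner (γ s) (velocity γ s) (velocity γ s)) 0 t :=
          (hasDerivAt_const t (1 : ℝ)).congr_of_eventuallyEq (by
            filter_upwards [hJ.mem_nhds ht] with s hs using hγ.inner_velocity hs)
        have h5 := h3.unique h4
        rw [← hT.covDeriv_eq, hc.symm (velocity γ t)] at h5
        have h6 : S.g.inner (γ t) (covDeriv S.g γ (velocity γ) t) (velocity γ t) = 0 := by linarith
        rw [h2, map_smul, ← hc.η_eq, smul_eq_mul] at h6
        rcases mul_eq_zero.1 h6 with h7 | h7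
        · rw [h7, zero_smul] at h2
          rw [h2] at hTT
          simp at hTT
        · exact h7
      · have h1 := hc.η_φ (velocity γ t)
        rw [ha, map_smul, smul_eq_mul] at h1
        exact (mul_eq_zero.1 h1).resolve_left h0
  obtain ⟨f, hf⟩ := hJ.exists_is_const_of_deriv_eq_zero hJc
    (fun t ht => (key t ht).differentiableAt.differentiableWithinAt)
    (fun t ht => (key t ht).deriv)
  exact ⟨f, fun t ht => hf t ht⟩

/-- Along `γ` one has `η(T) = f` and `φ T = σ E₂`, where `σ ≠ 0`. -/
structure IsSlantCurve (S : ContactMetricStructure n M) (J : Set ℝ) (γ : ℝ → M)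
    (E : ℕ → ∀ t, TangentSpace (𝓡 (2 * n + 1)) (γ t)) (f σ : ℝ) : Prop where
  ne_zero : σ ≠ 0
  sq_eq : σ ^ 2 = 1 - f ^ 2
  η_velocity : ∀ t ∈ J, S.η (γ t) (velocity γ t) = f
  φ_velocity : ∀ t ∈ J, S.φ (γ t) (velocity γ t) = σ • E 2 t

/-- If f² = 1, then T = fξ and ∇_T T = -fφT = 0, against κ₁ > 0. Otherwise φT = g(φT, E₂)E₂ with a
coefficient of square 1 - f²; its derivative is 0, so its sign cannot jump. -/
theorem exists_isSlantCurve (hS : S.IsSasakian) (hJ : IsOpen J) (hJc : IsConnected J)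
    (hγ : IsFrenetCurve S.g J γ r E κ) (hr : 2 ≤ r)
    (hpar : ∀ t ∈ J, Parallel (covDeriv S.g γ (velocity γ) t) (S.φ (γ t) (velocity γ t)))
    {f : ℝ} (hf : ∀ t ∈ J, S.η (γ t) (velocity γ t) = f) :
    ∃ σ, IsSlantCurve S J γ E f σ := by
  obtain ⟨t₀, ht₀⟩ := hJc.nonempty
  have hκ : ∀ t ∈ J, 0 < κ 1 t := fun t ht => hγ.curvature_pos t ht 1 le_rfl hr
  have hφφ : ∀ t ∈ J, S.g.inner (γ t) (S.φ (γ t) (velocity γ t)) (S.φ (γ t) (velocity γ t))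
      = 1 - f ^ 2 := by
    intro t ht
    rw [S.g_φ, hγ.inner_velocity ht, hf t ht]; ring
  have hf1 : 1 - f ^ 2 ≠ 0 := by
    intro h0
    have hφ : ∀ t ∈ J, S.φ (γ t) (velocity γ t) = 0 := by
      intro t ht
      by_contra hne
      have := S.g.pos _ _ hne
      rw [hφφ t ht, h0] at this
      exact lt_irrefl _ this
    have hT : ∀ t ∈ J, velocity γ t = f • S.ξ (γ t) := by
      intro t ht
      have := S.φ_sq (γ t) (velocity γ t)
      rw [hφ t ht, map_zero, eq_comm, neg_add_eq_zero, hf t ht] at this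
      exact this
    have h1 := hγ.hasCovDerivAt_velocity_of_two_le hJ ht₀ hr
    have h2 := (HasCovDerivAt.smul (hasDerivAt_const t₀ f)
      (hS.hasCovDerivAt_ξ h1.curve)).congr_of_eventuallyEq (W := velocity γ) (by
        filter_upwards [hJ.mem_nhds ht₀] with s hs using hT s hs)
    have h3 := h1.unique h2
    rw [hφ t₀ ht₀] at h3
    have h4 := congrArg (fun v => S.g.inner (γ t₀) v (E 2 t₀)) h3
    simp [hγ.inner_frame_self ht₀ one_le_two hr] at h4
    exact (hκ t₀ ht₀).ne' h4
  have hpt : ∀ t ∈ J, S.φ (γ t) (velocity γ t)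
      = S.g.inner (γ t) (S.φ (γ t) (velocity γ t)) (E 2 t) • E 2 t := by
    intro t ht
    have h22 := hγ.inner_frame_self ht one_le_two hr
    have : ∃ b : ℝ, S.φ (γ t) (velocity γ t) = b • E 2 t := by
      have h := hpar t ht
      rw [(hγ.hasCovDerivAt_velocity_of_two_le hJ ht hr).covDeriv_eq] at h
      rcases h with ⟨a, ha⟩ | ⟨a, ha⟩
      · have ha0 : a ≠ 0 := by
          rintro rfl
          have h4 := congrArg (fun v => S.g.inner (γ t) v (E 2 t)) ha
          simp [h22] at h4
          exact (hκ t ht).ne' h4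
        exact ⟨a⁻¹ * κ 1 t, by rw [mul_smul, ha, smul_smul, inv_mul_cancel₀ ha0, one_smul]⟩
      · exact ⟨a * κ 1 t, by rw [ha, smul_smul]⟩
    obtain ⟨b, hb⟩ := this
    rw [hb]
    simp [h22]
  have hsq : ∀ t ∈ J, S.g.inner (γ t) (S.φ (γ t) (velocity γ t)) (E 2 t) ^ 2 = 1 - f ^ 2 := by
    intro t ht
    have h := hφφ t ht
    rw [hpt t ht] at h
    simp only [map_smul, smul_apply, smul_eq_mul, hγ.inner_frame_self ht one_le_two hr] at h
    linarith
  have key : ∀ t ∈ J, HasDerivAt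
      (fun s => S.g.inner (γ s) (S.φ (γ s) (velocity γ s)) (E 2 s)) 0 t := by
    intro t ht
    have hc := S.isAlmostContact (γ t)
    have h1 := hγ.hasCovDerivAt_velocity_of_two_le hJ ht hr
    have h2 := hγ.hasCovDerivAt_frame hJ ht one_le_two hr
    have h := (hS.hasCovDerivAt_φ h1).inner h2
    refine h.congr_deriv ?_
    have hη : S.η (γ t) (E 2 t) = 0 := by
      have e := hc.η_φ (velocity γ t)
      rw [hpt t ht, map_smul, smul_eq_mul] at e
      refine (mul_eq_zero.1 e).resolve_left fun h0 => hf1 ?_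
      rw [← hsq t ht, h0]; norm_num
    have h3 : S.g.inner (γ t) (E 2 t) (if 2 < r then κ 2 t • E 3 t else 0) = 0 := by
      split_ifs with h3
      · rw [map_smul, hγ.orthonormal t ht 2 3 one_le_two hr (by omega) h3]; simp
      · simp
    rw [hpt t ht]
    simp only [Nat.one_lt_ofNat, if_true, Nat.reduceAdd, map_add, map_sub,
      map_smul, add_apply, sub_apply, smul_apply, smul_eq_mul, h3, hc.symm (S.ξ (γ t)), ← hc.η_eq,
      hη, hγ.inner_velocity_frame ht le_rfl hr, hc.symm (S.φ (γ t) (E 2 t)), hc.inner_φ_self,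
      hγ.frame_one t ht, hc.symm (E 2 t) (velocity γ t), Nat.reduceSub]
    simp
  obtain ⟨σ, hσ⟩ := hJ.exists_is_const_of_deriv_eq_zero hJc.isPreconnected
    (fun t ht => (key t ht).differentiableAt.differentiableWithinAt)
    (fun t ht => (key t ht).deriv)
  have hσ2 : σ ^ 2 = 1 - f ^ 2 := by rw [← hsq t₀ ht₀, hσ t₀ ht₀]
  refine ⟨σ, fun h0 => hf1 ?_, hσ2, hf, fun t ht => ?_⟩
  · rw [← hσ2, h0]; norm_num
  · have e := hpt t ht
    have e2 : S.g.inner (γ t) (S.φ (γ t) (velocity γ t)) (E 2 t) = σ := hσ t ht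
    rw [e2] at e
    exact e

namespace IsSlantCurve

variable {f σ : ℝ} (h : IsSlantCurve S J γ E f σ) (hγ : IsFrenetCurve S.g J γ r E κ) {t : ℝ}
  (ht : t ∈ J)

include h ht

theorem η_frame_two : S.η (γ t) (E 2 t) = 0 := by
  have e := (S.isAlmostContact (γ t)).η_φ (velocity γ t)
  rw [h.φ_velocity t ht, map_smul, smul_eq_mul] at e
  exact (mul_eq_zero.1 e).resolve_left h.ne_zero

theorem frame_two : E 2 t = σ⁻¹ • S.φ (γ t) (velocity γ t) := by
  rw [h.φ_velocity t ht, smul_smul, inv_mul_cancel₀ h.ne_zero, one_smul]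

include hγ

/-- The field ξ - fT is orthogonal to T and E₂ and has length |σ|. It stands in for E₃, which is a
Frenet vector only if r ≥ 3. -/
theorem inner_velocity_normal :
    S.g.inner (γ t) (velocity γ t) (S.ξ (γ t) - f • velocity γ t) = 0 := by
  rw [map_sub, map_smul, ← (S.isAlmostContact (γ t)).η_eq, h.η_velocity t ht,
    hγ.inner_velocity ht]
  simp

theorem inner_normal_self :
    S.g.inner (γ t) (S.ξ (γ t) - f • velocity γ t) (S.ξ (γ t) - f • velocity γ t) = σ ^ 2 := by
  have hc := S.isAlmostContact (γ t)
  simp only [map_sub, map_smul, sub_apply, smul_apply, smul_eq_mul, hc.symm (S.ξ (γ t)),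
    ← hc.η_eq, h.η_velocity t ht, hγ.inner_velocity ht, hc.η_ξ]
  rw [h.sq_eq]; ring

variable (hr : 2 ≤ r)

include hr

theorem inner_frame_two_normal :
    S.g.inner (γ t) (E 2 t) (S.ξ (γ t) - f • velocity γ t) = 0 := by
  have hc := S.isAlmostContact (γ t)
  rw [map_sub, map_smul, ← hc.η_eq, h.η_frame_two ht, hc.symm,
    hγ.inner_velocity_frame ht le_rfl hr]
  simp

variable (hS : S.IsSasakian) (hJ : IsOpen J)

include hS hJ

theorem hasCovDerivAt_frame_two :
    HasCovDerivAt S.g γ (E 2) t (-κ 1 t • velocity γ t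
      + (σ⁻¹ + κ 1 t * f * σ⁻¹ ^ 2) • (S.ξ (γ t) - f • velocity γ t)) := by
  have hc := S.isAlmostContact (γ t)
  have h1 := hγ.hasCovDerivAt_velocity_of_two_le hJ ht hr
  have h2 := (HasCovDerivAt.smul (hasDerivAt_const t σ⁻¹)
    (hS.hasCovDerivAt_φ h1)).congr_of_eventuallyEq (W := E 2) (by
      filter_upwards [hJ.mem_nhds ht] with s hs using h.frame_two hs)
  refine h2.congr_right ?_
  -- The term φ²T = -T + fξ equals -σ²T + f(ξ - fT); inserting the factor 1 = σ⁻²(1 - f²) lets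
  -- `module` see this.
  have e : -κ 1 t = -κ 1 t * (σ⁻¹ ^ 2 * (1 - f ^ 2)) := by
    rw [← h.sq_eq, ← mul_pow, inv_mul_cancel₀ h.ne_zero]; ring
  rw [hγ.inner_velocity ht, h.η_velocity t ht, map_smul, h.frame_two ht, map_smul, hc.φ_sq,
    h.η_velocity t ht, e]
  module

theorem hasCovDerivAt_normal :
    HasCovDerivAt S.g γ (fun s => S.ξ (γ s) - f • velocity γ s) t
      (-(σ + f * κ 1 t) • E 2 t) := by
  have h1 := hγ.hasCovDerivAt_velocity_of_two_le hJ ht hr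
  refine ((hS.hasCovDerivAt_ξ h1.curve).sub
    (HasCovDerivAt.smul (hasDerivAt_const t f) h1)).congr_right ?_
  rw [h.φ_velocity t ht]
  module

end IsSlantCurve

end SlantCurves

/-! ### The bitension field, the biharmonic equation and the osculating order -/

section Biharmonic

open scoped Topology

variable {n : ℕ} {M : Type*} [TopologicalSpace M]
  [ChartedSpace (EuclideanSpace ℝ (Fin (2 * n + 1))) M] [IsManifold (𝓡 (2 * n + 1)) ∞ M]
  {S : ContactMetricStructure n M} {c : ℝ} {J : Set ℝ} {γ : ℝ → M} {r : ℕ}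
  {E : ℕ → ∀ t, TangentSpace (𝓡 (2 * n + 1)) (γ t)} {κ : ℕ → ℝ → ℝ}

namespace IsFrenetCurve

variable (hγ : IsFrenetCurve S.g J γ r E κ) (hJ : IsOpen J) {t : ℝ} (ht : t ∈ J)

include hγ hJ ht

theorem hasDerivAt_curvature {i : ℕ} (hi : 1 ≤ i) (hi' : i < r) :
    HasDerivAt (κ i) (deriv (κ i) t) t :=
  (((hγ.smooth_curvature i hi hi').contDiffAt (hJ.mem_nhds ht)).differentiableAt
    (by simp)).hasDerivAt

theorem hasDerivAt_deriv_curvature {i : ℕ} (hi : 1 ≤ i) (hi' : i < r) :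
    HasDerivAt (deriv (κ i)) (deriv (deriv (κ i)) t) t := by
  have h := ((hγ.smooth_curvature i hi hi').deriv_of_isOpen hJ (m := 1) (by norm_cast)).contDiffAt
    (hJ.mem_nhds ht)
  exact (h.differentiableAt (by simp)).hasDerivAt

theorem tension_eq : tension S.g γ t = if 1 < r then κ 1 t • E 2 t else 0 :=
  (hγ.hasCovDerivAt_velocity hJ ht).covDeriv_eq

theorem tension_ne_zero (hr : 2 ≤ r) : tension S.g γ t ≠ 0 := by
  rw [hγ.tension_eq hJ ht, if_pos (show 1 < r from hr)]
  intro h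
  have h4 := congrArg (fun v => S.g.inner (γ t) v (E 2 t)) h
  simp [hγ.inner_frame_self ht one_le_two hr] at h4
  exact (hγ.curvature_pos t ht 1 le_rfl hr).ne' h4

end IsFrenetCurve

namespace IsSlantCurve

variable {f σ : ℝ} (h : IsSlantCurve S J γ E f σ) (hγ : IsFrenetCurve S.g J γ r E κ)
  (hr : 2 ≤ r) (hJ : IsOpen J)

include h hγ hr hJ

/-- Expanding in T, E₂ and ξ - fT instead of the Frenet frame treats all r ≥ 2 at once. -/
theorem bitension_eq (hS : S.IsSasakianSpaceForm c) {t : ℝ} (ht : t ∈ J) :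
    bitension S.g γ t = (-3 * κ 1 t * deriv (κ 1) t) • velocity γ t
      + (deriv (deriv (κ 1)) t - κ 1 t ^ 3 - κ 1 t * (1 + κ 1 t * f / σ) ^ 2
          + κ 1 t * (1 + (c - 1) * σ ^ 2)) • E 2 t
      + (deriv (κ 1) t * (2 * σ⁻¹ + 3 * (κ 1 t * f * σ⁻¹ ^ 2)))
          • (S.ξ (γ t) - f • velocity γ t) := by
  have hσ := h.ne_zero
  have e1 : ∀ s ∈ J, HasCovDerivAt S.g γ (tension S.g γ) s
      (deriv (κ 1) s • E 2 s + κ 1 s • (-κ 1 s • velocity γ s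
      + (σ⁻¹ + κ 1 s * f * σ⁻¹ ^ 2) • (S.ξ (γ s) - f • velocity γ s))) := by
    intro s hs
    refine (HasCovDerivAt.smul (hγ.hasDerivAt_curvature hJ hs le_rfl hr)
      (h.hasCovDerivAt_frame_two hγ hs hr hS.1 hJ)).congr_of_eventuallyEq ?_
    filter_upwards [hJ.mem_nhds hs] with x hx
    rw [hγ.tension_eq hJ hx, if_pos (show 1 < r from hr)]
  have d1 := hγ.hasDerivAt_curvature hJ ht le_rfl hr
  have d2 := hγ.hasDerivAt_deriv_curvature hJ ht le_rfl hr
  have d3 : HasDerivAt (fun s => σ⁻¹ + κ 1 s * f * σ⁻¹ ^ 2) (deriv (κ 1) t * f * σ⁻¹ ^ 2) t :=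
    ((d1.mul_const f).mul_const (σ⁻¹ ^ 2)).const_add σ⁻¹
  have c1 := hγ.hasCovDerivAt_velocity_of_two_le hJ ht hr
  have c2 := h.hasCovDerivAt_frame_two hγ ht hr hS.1 hJ
  have c3 := h.hasCovDerivAt_normal hγ ht hr hS.1 hJ
  have e2 := ((HasCovDerivAt.smul d2 c2).add (HasCovDerivAt.smul d1
    ((HasCovDerivAt.smul d1.neg c1).add (HasCovDerivAt.smul d3 c3)))).congr_of_eventuallyEq
    (W := covDeriv S.g γ (tension S.g γ)) (by
      filter_upwards [hJ.mem_nhds ht] with s hs using (e1 s hs).covDeriv_eq)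
  have hR : curvature S.g (γ t) (velocity γ t) (tension S.g γ t) (velocity γ t)
      = -(1 + (c - 1) * σ ^ 2) • κ 1 t • E 2 t := by
    have := hS.curvature_velocity (γ t) (hγ.inner_velocity ht) (κ 1 t * σ⁻¹)
    rw [h.η_velocity t ht, ← h.sq_eq, mul_smul, ← h.frame_two ht] at this
    rw [hγ.tension_eq hJ ht, if_pos (show 1 < r from hr), this]
  rw [bitension, e2.covDeriv_eq, hR]
  have e3 : κ 1 t * (1 + κ 1 t * f / σ) ^ 2
      = κ 1 t * ((σ⁻¹ + κ 1 t * f * σ⁻¹ ^ 2) * (σ + f * κ 1 t)) := by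
    field_simp
  rw [e3]
  simp only [Pi.neg_apply]
  module

/-- The T-component forces κ₁' = 0, since κ₁ > 0. The component along ξ - fT then vanishes too, and
the E₂-component divided by κ₁ is the stated equation. -/
theorem isBiharmonic_iff (hS : S.IsSasakianSpaceForm c) (hJc : IsConnected J) :
    IsBiharmonic S.g J γ ↔ ∃ a : ℝ, (∀ t ∈ J, κ 1 t = a)
      ∧ a ^ 2 + (1 + a * f / σ) ^ 2 = 1 + (c - 1) * σ ^ 2 := by
  constructor
  · intro hb
    have hT : ∀ t ∈ J, deriv (κ 1) t = 0 := by
      intro t ht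
      have e := hb t ht
      rw [h.bitension_eq hγ hr hJ hS ht] at e
      have e1 := congrArg (S.g.inner (γ t) (velocity γ t)) e
      simp only [map_add, map_smul, map_zero, hγ.inner_velocity ht,
        hγ.inner_velocity_frame ht le_rfl hr, h.inner_velocity_normal hγ ht, smul_eq_mul] at e1
      have := hγ.curvature_pos t ht 1 le_rfl hr
      have e2 : κ 1 t * deriv (κ 1) t = 0 := by linarith
      exact (mul_eq_zero.1 e2).resolve_left this.ne'
    obtain ⟨a, ha⟩ := hJ.exists_is_const_of_deriv_eq_zero hJc.isPreconnected
      (fun t ht =>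
        (hγ.hasDerivAt_curvature hJ ht le_rfl hr).differentiableAt.differentiableWithinAt) hT
    refine ⟨a, ha, ?_⟩
    obtain ⟨t, ht⟩ := hJc.nonempty
    have hT' : deriv (deriv (κ 1)) t = 0 := by
      have : deriv (κ 1) =ᶠ[𝓝 t] fun _ => (0 : ℝ) := by
        filter_upwards [hJ.mem_nhds ht] with s hs using hT s hs
      rw [this.deriv_eq]; simp
    have e := hb t ht
    rw [h.bitension_eq hγ hr hJ hS ht] at e
    have e1 := congrArg (S.g.inner (γ t) (E 2 t)) e
    simp only [map_add, map_smul, map_zero, hγ.inner_frame_self ht one_le_two hr,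
      h.inner_frame_two_normal hγ ht hr, S.g.symm (γ t) (E 2 t) (velocity γ t),
      hγ.inner_velocity_frame ht le_rfl hr, smul_eq_mul, hT', ha t ht] at e1
    have hpos := hγ.curvature_pos t ht 1 le_rfl hr
    rw [ha t ht] at hpos
    have e2 : a * (a ^ 2 + (1 + a * f / σ) ^ 2 - (1 + (c - 1) * σ ^ 2)) = 0 := by linarith
    linarith [(mul_eq_zero.1 e2).resolve_left hpos.ne']
  · rintro ⟨a, ha, hq⟩ t ht
    have hT : ∀ t ∈ J, deriv (κ 1) t = 0 := by
      intro t ht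
      have : κ 1 =ᶠ[𝓝 t] fun _ => a := by
        filter_upwards [hJ.mem_nhds ht] with s hs using ha s hs
      rw [this.deriv_eq]; simp
    have hT' : deriv (deriv (κ 1)) t = 0 := by
      have : deriv (κ 1) =ᶠ[𝓝 t] fun _ => (0 : ℝ) := by
        filter_upwards [hJ.mem_nhds ht] with s hs using hT s hs
      rw [this.deriv_eq]; simp
    have e : (0 : ℝ) - a ^ 3 - a * (1 + a * f / σ) ^ 2 + a * (1 + (c - 1) * σ ^ 2) = 0 := by
      rw [← hq]; ring
    rw [h.bitension_eq hγ hr hJ hS ht, hT t ht, hT', ha t ht, e]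
    simp

/-- Two formulas for ∇_T E₂ are compared: the Frenet one and the one obtained by differentiating
σ⁻¹φT. All information on κ₂ comes from here, by taking lengths. -/
theorem frenet_two (hS : S.IsSasakian) {t : ℝ} (ht : t ∈ J) :
    (if 2 < r then κ 2 t • E 3 t else 0)
      = (σ⁻¹ + κ 1 t * f * σ⁻¹ ^ 2) • (S.ξ (γ t) - f • velocity γ t) := by
  have h1 := (h.hasCovDerivAt_frame_two hγ ht hr hS hJ).unique
    (hγ.hasCovDerivAt_frame hJ ht one_le_two hr)
  simp only [Nat.one_lt_ofNat, if_true, Nat.reduceAdd, Nat.reduceSub, hγ.frame_one t ht] at h1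
  exact (add_left_cancel h1).symm

theorem curvature_eq_of_eq_two (hS : S.IsSasakian) (hr2 : r = 2) {t : ℝ} (ht : t ∈ J) :
    1 + κ 1 t * f / σ = 0 := by
  have hσ := h.ne_zero
  have h1 := h.frenet_two hγ hr hJ hS ht
  rw [if_neg (by omega)] at h1
  have h2 := congrArg (S.g.inner (γ t) (S.ξ (γ t) - f • velocity γ t)) h1
  rw [map_zero, map_smul, h.inner_normal_self hγ ht, smul_eq_mul] at h2
  have h3 : σ⁻¹ + κ 1 t * f * σ⁻¹ ^ 2 = 0 :=
    (mul_eq_zero.1 h2.symm).resolve_right (pow_ne_zero 2 hσ)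
  field_simp at h3 ⊢
  linarith

theorem curvature_two_sq (hS : S.IsSasakian) (hr3 : 3 ≤ r) {t : ℝ} (ht : t ∈ J) :
    κ 2 t ^ 2 = (1 + κ 1 t * f / σ) ^ 2 := by
  have hσ := h.ne_zero
  have h1 := h.frenet_two hγ hr hJ hS ht
  rw [if_pos (by omega)] at h1
  have h2 := congrArg (fun v => S.g.inner (γ t) v v) h1
  simp only [map_smul, smul_apply, smul_eq_mul, h.inner_normal_self hγ ht,
    hγ.inner_frame_self ht (i := 3) (by norm_num) hr3] at h2
  have h3 : κ 2 t ^ 2 = (σ⁻¹ + κ 1 t * f * σ⁻¹ ^ 2) ^ 2 * σ ^ 2 := by linarith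
  rw [h3]
  field_simp

/-- Otherwise κ₂E₃ is a multiple of ξ - fT, so its covariant derivative lies in the span of ξ - fT
and E₂. Pairing with E₄ yields κ₂κ₃ = 0. -/
theorem order_le_three (hS : S.IsSasakian) {t : ℝ} (ht : t ∈ J) : r ≤ 3 := by
  by_contra! hr4
  have hκ2 : ∀ s ∈ J, 0 < κ 2 s := fun s hs => hγ.curvature_pos s hs 2 (by norm_num) (by omega)
  have hκ3 := hγ.curvature_pos t ht 3 (by norm_num) hr4
  have h1 : ∀ s ∈ J, κ 2 s • E 3 s
      = (σ⁻¹ + κ 1 s * f * σ⁻¹ ^ 2) • (S.ξ (γ s) - f • velocity γ s) := by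
    intro s hs
    have := h.frenet_two hγ hr hJ hS hs
    rwa [if_pos (by omega)] at this
  -- A nonzero coefficient makes ξ - fT a multiple of E₃, hence orthogonal to E₄.
  have hne : σ⁻¹ + κ 1 t * f * σ⁻¹ ^ 2 ≠ 0 := by
    intro h0
    have h2 := congrArg (fun v => S.g.inner (γ t) v (E 3 t)) (h1 t ht)
    rw [h0, zero_smul] at h2
    simp [hγ.inner_frame_self ht (i := 3) (by norm_num) (by omega)] at h2
    exact (hκ2 t ht).ne' h2
  have hi : ∀ i, 1 ≤ i → i < 4 → S.g.inner (γ t) (E i t) (E 4 t) = 0 := fun i hi hi' => by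
    rw [hγ.orthonormal t ht i 4 hi (by omega) (by norm_num) hr4, if_neg (by omega)]
  have hN : S.g.inner (γ t) (S.ξ (γ t) - f • velocity γ t) (E 4 t) = 0 := by
    have h2 := congrArg (fun v => S.g.inner (γ t) v (E 4 t)) (h1 t ht)
    simp only [map_smul, smul_apply, hi 3 (by norm_num) (by norm_num), smul_eq_mul,
      mul_zero] at h2
    exact (mul_eq_zero.1 h2.symm).resolve_left hne
  have d1 := hγ.hasDerivAt_curvature hJ ht le_rfl hr
  have d2 := hγ.hasDerivAt_curvature hJ ht (i := 2) (by norm_num) (by omega)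
  have d3 : HasDerivAt (fun s => σ⁻¹ + κ 1 s * f * σ⁻¹ ^ 2) (deriv (κ 1) t * f * σ⁻¹ ^ 2) t :=
    ((d1.mul_const f).mul_const (σ⁻¹ ^ 2)).const_add σ⁻¹
  have c3 := HasCovDerivAt.smul d3 (h.hasCovDerivAt_normal hγ ht hr hS hJ)
  have c4 := HasCovDerivAt.smul d2 (hγ.hasCovDerivAt_frame hJ ht (i := 3) (by norm_num) (by omega))
  have e := c4.unique (c3.congr_of_eventuallyEq (by
    filter_upwards [hJ.mem_nhds ht] with s hs using h1 s hs))
  have e1 := congrArg (fun v => S.g.inner (γ t) v (E 4 t)) e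
  rw [if_pos (by norm_num), if_pos (by omega)] at e1
  simp only [map_add, map_smul, add_apply, smul_apply, smul_eq_mul, Nat.reduceSub,
    Nat.reduceAdd, hi 3 (by norm_num) (by norm_num), hi 2 (by norm_num) (by norm_num), hN,
    hγ.inner_frame_self ht (i := 4) (by norm_num) hr4] at e1
  have := mul_pos (hκ2 t ht) hκ3
  linarith

end IsSlantCurve

end Biharmonic

/-! ### The quadratic equations behind the two cases -/

theorem biharmonic_equation_iff {a c f σ : ℝ} (hσ : σ ≠ 0) (h : σ ^ 2 = 1 - f ^ 2) :
    a ^ 2 + (1 + a * f / σ) ^ 2 = 1 + (c - 1) * σ ^ 2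
      ↔ a ^ 2 + 2 * σ * f * a + (1 - c) * σ ^ 4 = 0 := by
  have e : a ^ 2 + 2 * σ * f * a + (1 - c) * σ ^ 4
      = σ ^ 2 * (a ^ 2 + (1 + a * f / σ) ^ 2 - (1 + (c - 1) * σ ^ 2)) := by
    have e1 : σ ^ 2 * (1 + a * f / σ) ^ 2 = (σ + a * f) ^ 2 := by field_simp
    have e2 : a ^ 2 * f ^ 2 = a ^ 2 * (1 - σ ^ 2) := by rw [h]; ring
    linear_combination -e1 - e2
  rw [e, mul_eq_zero, or_iff_right (pow_ne_zero 2 hσ), sub_eq_zero]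

/-- As c² - 2c + 5 = (c-1)² + 4, the root with +√ is negative for c < 1 and exceeds 1 for c > 1, so
it lies outside (0, 1). -/
theorem circle_angle_eq {c x : ℝ} (hc : c ≠ 1) (hx0 : 0 < x) (hx1 : x < 1)
    (h : (c - 1) * x ^ 2 - (c + 1) * x + 1 = 0) :
    x = (c + 1 - √(c ^ 2 - 2 * c + 5)) / (2 * (c - 1)) := by
  have hpos : 0 ≤ c ^ 2 - 2 * c + 5 := by nlinarith [sq_nonneg (c - 1)]
  set D := √(c ^ 2 - 2 * c + 5)
  have hD : D ^ 2 = c ^ 2 - 2 * c + 5 := Real.sq_sqrt hpos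
  have hD0 : 0 ≤ D := Real.sqrt_nonneg _
  have hc' : c - 1 ≠ 0 := sub_ne_zero.2 hc
  have h1 : (2 * (c - 1) * x - (c + 1) - D) * (2 * (c - 1) * x - (c + 1) + D) = 0 := by
    linear_combination 4 * (c - 1) * h - hD
  rcases mul_eq_zero.1 h1 with h2 | h2
  · exfalso
    rcases lt_or_gt_of_ne hc with hlt | hgt
    · have : (c - 1) * x < 0 := mul_neg_of_neg_of_pos (by linarith) hx0
      nlinarith
    · have : (c - 1) * x < c - 1 := by nlinarith
      nlinarith
  · field_simp
    linarith

end SasakianCurves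

/-! ### The classification -/

open SasakianCurves in
theorem mainTheorem3 {n : ℕ} {M : Type*} [TopologicalSpace M]
    [ChartedSpace (EuclideanSpace ℝ (Fin (2 * n + 1))) M] [IsManifold (𝓡 (2 * n + 1)) ∞ M]
    (S : SasakianCurves.ContactMetricStructure n M) (c : ℝ) (hS : S.IsSasakianSpaceForm c)
    (hc : c ≠ 1)
    (J : Set ℝ) (hJ : IsOpen J) (hJc : IsConnected J) (γ : ℝ → M) (r : ℕ)
    (E : ℕ → ∀ t, TangentSpace (𝓡 (2 * n + 1)) (γ t)) (κ : ℕ → ℝ → ℝ)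
    (hγ : SasakianCurves.IsFrenetCurve S.g J γ r E κ)
    (hnonLegendre : ∃ t ∈ J, S.η (γ t) (SasakianCurves.velocity γ t) ≠ 0)
    (hpar : ∀ t ∈ J, SasakianCurves.Parallel
      (SasakianCurves.covDeriv S.g γ (SasakianCurves.velocity γ) t)
      (S.φ (γ t) (SasakianCurves.velocity γ t))) :
    r ≤ 3 ∧
    (SasakianCurves.IsProperBiharmonic S.g J γ ↔
      SasakianCurves.CircleCondition S c J γ r κ ∨
        ∃ β₀ ε : ℝ, SasakianCurves.HelixCondition S c J γ r E κ β₀ ε) ∧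
    ∀ β₀ ε : ℝ, SasakianCurves.HelixCondition S c J γ r E κ β₀ ε →
      ∀ t ∈ J, κ 2 t ^ 2 = (κ 1 t * Real.cot β₀ + ε) ^ 2 := by
  obtain ⟨f, hf⟩ := exists_η_velocity_eq hS.1 hJ hJc.isPreconnected hγ hpar
  obtain ⟨t₀, ht₀, hne⟩ := hnonLegendre
  have hf0 : f ≠ 0 := by rwa [hf t₀ ht₀] at hne
  -- For r = 1 the curve is a geodesic, hence harmonic, while both conditions require r ≥ 2.
  by_cases hr : 2 ≤ r
  swap
  · have hharm : IsHarmonic S.g J γ := fun t ht => by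
      rw [hγ.tension_eq hJ ht, if_neg (by omega)]
    refine ⟨by omega, ⟨fun h => (h.2 hharm).elim, ?_⟩, ?_⟩
    · rintro (h | ⟨β, ε, h⟩)
      · exact (hr h.1.1.ge).elim
      · have := h.1.1; omega
    · intro β ε h
      have := h.1.1; omega
  obtain ⟨σ, h⟩ := exists_isSlantCurve hS.1 hJ hJc hγ hr hpar hf
  have hσ := h.ne_zero
  have hσ2 := h.sq_eq
  have hr3 := h.order_le_three hγ hr hJ hS.1 ht₀
  have hnh : ¬ IsHarmonic S.g J γ := fun hh => hγ.tension_ne_zero hJ ht₀ hr (hh t₀ ht₀)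
  have hproper : IsProperBiharmonic S.g J γ ↔ ∃ a : ℝ, (∀ t ∈ J, κ 1 t = a)
      ∧ a ^ 2 + (1 + a * f / σ) ^ 2 = 1 + (c - 1) * σ ^ 2 :=
    (and_iff_left hnh).trans (h.isBiharmonic_iff hγ hr hJ hS hJc)
  have hx0 : 0 < f ^ 2 := by positivity
  have hx1 : f ^ 2 < 1 := by
    have : 0 < σ ^ 2 := by positivity
    linarith
  have hσε : ∀ β ε : ℝ, HelixCondition S c J γ r E κ β ε → σ = ε * Real.sin β := by
    rintro β ε ⟨-, -, -, -, -, hφ, -⟩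
    have e := (h.φ_velocity t₀ ht₀).symm.trans (hφ t₀ ht₀)
    have e1 := congrArg (fun v => S.g.inner (γ t₀) v (E 2 t₀)) e
    simpa [hγ.inner_frame_self ht₀ one_le_two hr] using e1
  have hcos : ∀ β ε : ℝ, HelixCondition S c J γ r E κ β ε → f = Real.cos β := by
    rintro β ε ⟨-, -, -, -, hη, -, -⟩
    exact (hf t₀ ht₀).symm.trans (hη t₀ ht₀)
  refine ⟨hr3, hproper.trans ⟨?_, ?_⟩, ?_⟩
  · rintro ⟨a, ha, hq⟩
    obtain hr2 | hr3' : r = 2 ∨ r = 3 := by omega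
    · left
      have h0 : 1 + a * f / σ = 0 := by
        rw [← ha t₀ ht₀]; exact h.curvature_eq_of_eq_two hγ hr hJ hS.1 hr2 ht₀
      rw [h0] at hq
      have h1 : σ + a * f = 0 := by
        field_simp at h0; simpa using h0
      have h2 : a ^ 2 * f ^ 2 = σ ^ 2 := by
        rw [← mul_pow, show a * f = -σ by linarith, neg_sq]
      -- Here a² = 1 + (c-1)σ² and a²f² = σ²; eliminating a² and σ² = 1 - f² leaves a quadratic
      -- equation for f².
      have hx := circle_angle_eq (c := c) hc hx0 hx1 (by
        linear_combination f ^ 2 * hq - h2 - (1 - (c - 1) * f ^ 2) * hσ2)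
      refine ⟨⟨hr2, a, ha⟩, ?_, fun t ht => ?_⟩
      · rw [← hx, Real.sqrt_sq_eq_abs]
        rcases lt_or_gt_of_ne hf0 with hlt | hgt
        · exact ⟨-1, Or.inr rfl, fun t ht => by rw [hf t ht, abs_of_neg hlt]; ring⟩
        · exact ⟨1, Or.inl rfl, fun t ht => by rw [hf t ht, abs_of_pos hgt]; ring⟩
      · have hc' : c - 1 ≠ 0 := sub_ne_zero.2 hc
        have hx' : 2 * (c - 1) * f ^ 2 = c + 1 - √(c ^ 2 - 2 * c + 5) := by
          rw [hx]; field_simp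
        rw [ha t ht]
        linear_combination hq + (c - 1) * hσ2 - hx' / 2
    · right
      have hq' := (biharmonic_equation_iff hσ hσ2).1 hq
      have hf1 : -1 < f ∧ f < 1 := abs_lt.1 (by
        rw [← sq_lt_one_iff_abs_lt_one]; exact hx1)
      -- The angle is taken in (0, π), where sin β₀ = |σ|, and ε carries the sign of σ.
      have hcosβ : Real.cos (Real.arccos f) = f := Real.cos_arccos hf1.1.le hf1.2.le
      have hsinβ : Real.sin (Real.arccos f) = |σ| := by
        rw [Real.sin_arccos, ← hσ2, Real.sqrt_sq_eq_abs]
      obtain ⟨ε, hε, hεσ⟩ : ∃ ε : ℝ, (ε = 1 ∨ ε = -1) ∧ ε * |σ| = σ := by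
        rcases lt_or_gt_of_ne hσ with hlt | hgt
        · exact ⟨-1, Or.inr rfl, by rw [abs_of_neg hlt]; ring⟩
        · exact ⟨1, Or.inl rfl, by rw [abs_of_pos hgt]; ring⟩
      have hβ0 : 0 < Real.arccos f := Real.arccos_pos.2 hf1.2
      have hβπ : Real.arccos f < Real.pi := by
        refine (Real.arccos_le_pi f).lt_of_ne fun e => ?_
        rw [e, Real.cos_pi] at hcosβ
        linarith [hf1.1]
      refine ⟨Real.arccos f, ε, ⟨hr3', ⟨a, ha⟩, √((1 + a * f / σ) ^ 2), fun t ht => ?_⟩,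
        ⟨⟨hβ0, by linarith⟩, ?_⟩, fun hc1 => ?_, hε, fun t ht => ?_, fun t ht => ?_,
        fun t ht => ?_⟩
      · rw [← ha t ht, ← h.curvature_two_sq hγ hr hJ hS.1 hr3'.ge ht, Real.sqrt_sq]
        exact (hγ.curvature_pos t ht 2 one_le_two (by omega)).le
      · simp only [Set.mem_insert_iff, Set.mem_singleton_iff, not_or]
        refine ⟨fun e => ?_, hβπ.ne, fun e => ?_⟩
        · rw [e, Real.cos_pi_div_two] at hcosβ
          exact hf0 hcosβ.symm
        · linarith [Real.pi_pos]
      · rw [hcosβ, ← Real.sqrt_sq_eq_abs]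
        apply Real.sqrt_le_sqrt
        -- Completing the square in a: f² ≥ (1-c)σ² with σ² = 1 - f² is the required bound, because
        -- c - 2 < 0.
        have h1 : σ ^ 2 * (f ^ 2 - (1 - c) * σ ^ 2) = (a + σ * f) ^ 2 := by
          linear_combination -hq'
        have h2 : 0 ≤ f ^ 2 - (1 - c) * σ ^ 2 :=
          nonneg_of_mul_nonneg_right (h1 ▸ sq_nonneg _) (by positivity)
        rw [hσ2] at h2
        rw [div_le_iff_of_neg (by linarith)]
        linarith
      · rw [hf t ht, hcosβ]
      · rw [hsinβ, hεσ, h.φ_velocity t ht]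
      · rw [ha t ht, Real.sin_two_mul, hcosβ, hsinβ, (by decide : Even 4).pow_abs]
        linear_combination hq' + 2 * f * a * hεσ
  · rintro (⟨⟨hr2, a, ha⟩, ⟨ε, hε, hη⟩, hκ⟩ | ⟨β, ε, hβ⟩)
    · refine ⟨a, ha, ?_⟩
      have h0 : 1 + a * f / σ = 0 := by
        rw [← ha t₀ ht₀]; exact h.curvature_eq_of_eq_two hγ hr hJ hS.1 hr2 ht₀
      have h1 := hκ t₀ ht₀
      have h2 := hη t₀ ht₀
      rw [hf t₀ ht₀] at h2
      have hε2 : ε ^ 2 = 1 := by rcases hε with rfl | rfl <;> norm_num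
      -- A negative radicand would have `√` equal to 0 and thus give f = 0, which is excluded.
      have hX : 0 ≤ (c + 1 - √(c ^ 2 - 2 * c + 5)) / (2 * (c - 1)) := by
        by_contra! hX
        rw [Real.sqrt_eq_zero_of_nonpos hX.le, mul_zero] at h2
        exact hf0 h2
      have hx : f ^ 2 = (c + 1 - √(c ^ 2 - 2 * c + 5)) / (2 * (c - 1)) := by
        rw [h2, mul_pow, hε2, one_mul, Real.sq_sqrt hX]
      have hc' : c - 1 ≠ 0 := sub_ne_zero.2 hc
      have hx' : 2 * (c - 1) * f ^ 2 = c + 1 - √(c ^ 2 - 2 * c + 5) := by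
        rw [hx]; field_simp
      rw [ha t₀ ht₀] at h1
      rw [h0]
      linear_combination h1 - (c - 1) * hσ2 + hx' / 2
    · obtain ⟨a, ha⟩ := hβ.1.2.1
      refine ⟨a, ha, (biharmonic_equation_iff hσ hσ2).2 ?_⟩
      have e1 := hσε β ε hβ
      have e2 := hcos β ε hβ
      obtain ⟨-, -, -, hε, -, -, hq⟩ := hβ
      have e3 := hq t₀ ht₀
      rw [ha t₀ ht₀, Real.sin_two_mul] at e3
      have hε4 : ε ^ 4 = 1 := by rcases hε with rfl | rfl <;> norm_num
      rw [e1, e2, mul_pow, hε4]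
      linear_combination e3
  · intro β ε hβ t ht
    have e1 := hσε β ε hβ
    have e2 := hcos β ε hβ
    have hs : Real.sin β ≠ 0 := by
      intro h0
      rw [h0, mul_zero] at e1
      exact hσ e1
    rw [h.curvature_two_sq hγ hr hJ hS.1 hβ.1.1.ge ht, e1, e2, Real.cot_eq_cos_div_sin]
    -- With σ = ε sin β₀ and ε² = 1, the factor ε can be moved from the cotangent term to the
    -- constant term inside the square.
    rcases hβ.2.2.2.1 with rfl | rfl
    · field_simp; ring
    · field_simp; ring
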